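/- Let $\Gamma$ denote a finite simplicial graph that is connected and anti-connected (its complement graph is connected), and let $A(\Gamma)$ be the right-angled Artin group generated by the vertices of $\Gamma$ subject to the relations that adjacent vertices commute. Identify the $1$-skeleton of the universal cover of the Salvetti complex of $\Gamma$ with the Cayley graph of $A(\Gamma)$ with respect to the vertex generators, and give it its path metric (the combinatorial distance). A word in the vertex generators and their inverses is reduced if it is shortest among the words representing the same element; it is a join word if all vertices occurring in it lie in an induced subgraph $J$ of $\Gamma$ whose vertex set is a union of two nonempty sets such that every vertex of the first is adjacent to every vertex of the second. An element $g\in A(\Gamma)$ is $N$-join-busting if, for every reduced word $w$ representing $g$, every consecutive subword of $w$ that is a join word represents an element of word length at most $N$. A subgroup is join-busting if for some $N$ all its elements are $N$-join-busting. A $K$-quasi-geodesic is a map $f$ from an interval of $\mathbb R$ or $\mathbb Z$ with $\frac1K|s-t|-K\le d(f(s),f(t))\le K|s-t|+K$ for all $s,t$; an edge path is a $K$-quasi-geodesic if its sequence of vertices is one, and Hausdorff distances of edge paths are taken between their vertex sets. (1) For all $K\ge 1$ and all integers $N\ge 0$ there is $M=M(K,N)$, depending only on $K$ and $N$, such that for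 every such $\Gamma$ and every $N$-join-busting $g\in A(\Gamma)$, every $K$-quasi-geodesic edge path from $1$ to $g$ has Hausdorff distance at most $M$ from every combinatorial geodesic from $1$ to $g$. (2) For every such $\Gamma$, every finitely generated join-busting subgroup $H\le A(\Gamma)$ is stable in $A(\Gamma)$: the inclusion $H\to A(\Gamma)$ is a quasi-isometric embedding for the word metrics of all finite generating sets of $H$ and $A(\Gamma)$, and for every word metric on $A(\Gamma)$ given by a finite generating set and every $K\ge 1$ there is $M\ge 0$ such that any two $K$-quasi-geodesics in $A(\Gamma)$ with common endpoints in $H$ have Hausdorff distance at most $M$. Moreover $H$ is combinatorially quasiconvex: there is $R$ such that every combinatorial geodesic with endpoints in $H$ lies in the $R$-neighbourhood of $H$. -/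

import Mathlib

/-! ### Coarse geometry

Distances are passed explicitly as functions `X → X → ℝ`. -/

/-- On the subset `s` of `X`, the map `f : X → Y` is a `(K, L)`-quasi-isometric embedding. -/
def IsQIEmbeddingOn {X Y : Type*} (dX : X → X → ℝ) (dY : Y → Y → ℝ) (K L : ℝ)
    (s : Set X) (f : X → Y) : Prop :=
  ∀ x₁ ∈ s, ∀ x₂ ∈ s,
    1 / K * dX x₁ x₂ - L ≤ dY (f x₁) (f x₂) ∧ dY (f x₁) (f x₂) ≤ K * dX x₁ x₂ + L

/-- `A` is the image of a `K`-quasi-geodesic, that is, of a `(K, K)`-quasi-isometric embedding,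
from `x` to `y` in `(X, d)`, parametrised by a closed interval of `T` (here `T` is `ℝ` or `ℤ`). -/
def IsQuasiGeodesicImage (T : Type) [PseudoMetricSpace T] [Preorder T] {X : Type*}
    (d : X → X → ℝ) (K : ℝ) (x y : X) (A : Set X) : Prop :=
  ∃ (a b : T) (f : T → X), a ≤ b ∧ IsQIEmbeddingOn dist d K K (Set.Icc a b) f ∧
    f a = x ∧ f b = y ∧ f '' Set.Icc a b = A

/-- The Hausdorff distance of `A` and `B` with respect to `d` is at most `M`. The distances used
below take values in `ℕ`, so infima of distances are attained. -/
def HausdorffDistLE {X : Type*} (d : X → X → ℝ) (M : ℝ) (A B : Set X) : Prop :=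
  (∀ a ∈ A, ∃ b ∈ B, d a b ≤ M) ∧ (∀ b ∈ B, ∃ a ∈ A, d a b ≤ M)

/-! ### Edge paths in graphs -/

/-- The combinatorial distance of a graph, as a real number. -/
noncomputable def graphDist {X : Type*} (G : SimpleGraph X) (x y : X) : ℝ := (G.dist x y : ℝ)

/-- An edge path which is as short as possible among those with the same endpoints. -/
def SimpleGraph.Walk.IsGeodesicPath {X : Type*} {G : SimpleGraph X} {x y : X}
    (p : G.Walk x y) : Prop :=
  p.length = G.dist x y

/-- The sequence of vertices of the edge path is a `K`-quasi-geodesic. -/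
def SimpleGraph.Walk.IsQuasiGeodesicPath {X : Type*} {G : SimpleGraph X} {x y : X}
    (K : ℝ) (p : G.Walk x y) : Prop :=
  IsQIEmbeddingOn (fun i j : ℕ => |(i : ℝ) - j|) (graphDist G) K K {i : ℕ | i ≤ p.length} p.getVert

/-- The set of vertices of the edge path. -/
def SimpleGraph.Walk.vertexSet {X : Type*} {G : SimpleGraph X} {x y : X}
    (p : G.Walk x y) : Set X :=
  {z | z ∈ p.support}

/-- `C` is quasiconvex in `G`: for some `R`, geodesic edge paths with endpoints in `C` stay in the
`R`-neighbourhood of `C`. -/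
def SimpleGraph.IsQuasiconvex {X : Type*} (G : SimpleGraph X) (C : Set X) : Prop :=
  ∃ R : ℝ, ∀ x ∈ C, ∀ y ∈ C, ∀ p : G.Walk x y, p.IsGeodesicPath →
    ∀ z ∈ p.vertexSet, ∃ c ∈ C, graphDist G z c ≤ R

/-! ### Word metrics and stable subgroups -/

/-- The word metric of `G` with respect to the generating set `S`: the path metric on the vertices
of the Cayley graph, in which `g` is adjacent to `g * s` for `s ∈ S`. -/
noncomputable def wordDist {G : Type*} [Group G] (S : Set G) : G → G → ℝ :=
  graphDist (SimpleGraph.mulCayley S)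

/-- The finite set `S` generates `G`. -/
def IsFiniteGenSet {G : Type*} [Group G] (S : Set G) : Prop :=
  S.Finite ∧ Subgroup.closure S = ⊤

/-- The inclusion of `H` in `G` is a quasi-isometric embedding for all word metrics given by finite
generating sets `T` of `H` and `S` of `G`. -/
def Subgroup.IsUndistorted {G : Type*} [Group G] (H : Subgroup G) : Prop :=
  ∀ (S : Set G) (T : Set H), IsFiniteGenSet S → IsFiniteGenSet T →
    ∃ K L : ℝ, 1 ≤ K ∧ 0 ≤ L ∧
      IsQIEmbeddingOn (wordDist T) (wordDist S) K L Set.univ (fun h : H => (h : G))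

/-- The finitely generated subgroup `H` of the finitely generated group `G` is stable: it is
undistorted, and for every word metric on `G` and every `K ≥ 1` there is a bound on the Hausdorff
distance of two `K`-quasi-geodesics in `G` with common endpoints in `H`. -/
structure Subgroup.IsStable {G : Type*} [Group G] (H : Subgroup G) : Prop where
  group_fg : Group.FG G
  subgroup_fg : H.FG
  undistorted : H.IsUndistorted
  quasiGeodesics_close : ∀ S : Set G, IsFiniteGenSet S → ∀ K : ℝ, 1 ≤ K →
    ∃ M : ℝ, 0 ≤ M ∧ ∀ x ∈ H, ∀ y ∈ H, ∀ A B : Set G,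
      (IsQuasiGeodesicImage ℝ (wordDist S) K x y A ∨
        IsQuasiGeodesicImage ℤ (wordDist S) K x y A) →
      (IsQuasiGeodesicImage ℝ (wordDist S) K x y B ∨
        IsQuasiGeodesicImage ℤ (wordDist S) K x y B) →
      HausdorffDistLE (wordDist S) M A B

/-! ### Right-angled Artin groups -/

/-- The right-angled Artin group of `Γ`: generators the vertices, relators the commutators of
adjacent vertices. -/
abbrev RAAG {V : Type*} (Γ : SimpleGraph V) : Type _ :=
  PresentedGroup
    {r : FreeGroup V | ∃ v w : V, Γ.Adj v w ∧
      r = FreeGroup.of v * FreeGroup.of w * (FreeGroup.of v)⁻¹ * (FreeGroup.of w)⁻¹}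

namespace RAAG

variable {V : Type*} (Γ : SimpleGraph V)

/-- The vertex generators. -/
def gen (v : V) : RAAG Γ := PresentedGroup.of v

/-- The set of vertex generators. -/
def gens : Set (RAAG Γ) := Set.range (gen Γ)

/-- The `1`-skeleton of the universal cover of the Salvetti complex of `Γ`, that is, the Cayley
graph of `RAAG Γ` with respect to the vertex generators; the base point is `1`. -/
def oneSkeleton : SimpleGraph (RAAG Γ) := SimpleGraph.mulCayley (gens Γ)

/-- The length of an element with respect to the vertex generators. -/
noncomputable def length (g : RAAG Γ) : ℕ := (oneSkeleton Γ).dist 1 g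

/-- The element represented by a word in the vertex generators; the letter `(v, true)` stands for
`v` and `(v, false)` for its inverse. -/
def eval (w : List (V × Bool)) : RAAG Γ :=
  (w.map fun x => if x.2 then gen Γ x.1 else (gen Γ x.1)⁻¹).prod

/-- A word is reduced if it is shortest among all words representing the same element. -/
def IsReduced (w : List (V × Bool)) : Prop :=
  ∀ w' : List (V × Bool), eval Γ w' = eval Γ w → w.length ≤ w'.length

/-- The induced subgraph of `Γ` on `J` is a join of two nonempty subgraphs. -/
def IsJoin (J : Set V) : Prop :=
  ∃ A B : Set V, A.Nonempty ∧ B.Nonempty ∧ A ∪ B = J ∧ ∀ a ∈ A, ∀ b ∈ B, Γ.Adj a b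

/-- A word is a join word if its support is contained in a join of `Γ`. -/
def IsJoinWord (w : List (V × Bool)) : Prop :=
  ∃ J : Set V, IsJoin Γ J ∧ ∀ x ∈ w, x.1 ∈ J

/-- The element `g` is `N`-join-busting: join subwords (consecutive letters) of reduced words
representing `g` have length at most `N`. -/
def IsJoinBusting (N : ℕ) (g : RAAG Γ) : Prop :=
  ∀ w : List (V × Bool), eval Γ w = g → IsReduced Γ w →
    ∀ w' : List (V × Bool), w' <:+: w → IsJoinWord Γ w' → length Γ (eval Γ w') ≤ N

/-- A subgroup is join-busting if its elements are `N`-join-busting for some uniform `N`. -/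
def IsJoinBustingSubgroup (H : Subgroup (RAAG Γ)) : Prop :=
  ∃ N : ℕ, ∀ h ∈ H, IsJoinBusting Γ N h

end RAAG

namespace RAAG

variable {V : Type*} {Γ : SimpleGraph V}

/-! ### Homomorphisms from right-angled Artin groups -/

/-! The Cayley graph is a median graph, and the geometry is read off from its walls. Group-valued
weights on walls that commute for adjacent labels integrate to functions on the group
(`exists_potential`). Signs as weights show that walls have two sides, so that distance counts
separating walls (`rdist_eq_ncard`); non-commuting weights show that crossing walls have adjacent
labels (`adj_of_crossing`).

A vertex and its link span a join. Hence, for a join-busting pair `a`, `b`, a piece of a geodesic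
whose walls all cross one fixed wall has length at most `N`. This makes the median projection to the
interval from `a` to `b` contracting: a wall separating `x` from its projection `m` and also `y`
from its projection `n` crosses every wall between `m` and `n`, so these are `2N`-close; without
such a wall, some geodesic from `x` to `y` passes through `m` and `n`
(`JoinBustingPair.contraction`). Contraction gives the Morse property with constants in `K` and `N`
only (`le_morseBound`). The interval is also thin, since incomparable vertices branch off from their
median with `a` along two families of walls that span a join (`JoinBustingPair.rdist_le_of_btw`).
This yields (1), and, after sampling and a change of generators, the closeness of quasi-geodesics in
(2).

For quasiconvexity, a wall crossed by a geodesic between points of `H` is also crossed by a path of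
generators of `H`. The walls between the two crossing places have labels adjacent to its label, so
join-busting bounds how far apart the places are (`JoinBustingPair.rdist_le_of_common_wall`).
Quasiconvexity in turn makes `H` undistorted. -/

/-- The homomorphism determined by images of the vertex generators. -/
def lift {P : Type*} [Group P] (f : V → P) (hf : ∀ v w, Γ.Adj v w → Commute (f v) (f w)) :
    RAAG Γ →* P :=
  PresentedGroup.toGroup (f := f) (by
    rintro r ⟨v, w, h, rfl⟩
    have := (hf v w h).eq
    simp [this])

theorem lift_gen {P : Type*} [Group P] (f : V → P)
    (hf : ∀ v w, Γ.Adj v w → Commute (f v) (f w)) (v : V) : lift f hf (gen Γ v) = f v :=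
  PresentedGroup.toGroup.of _

theorem commute_gen {v w : V} (h : Γ.Adj v w) : Commute (gen Γ v) (gen Γ w) := by
  have : (PresentedGroup.mk {r : FreeGroup V | ∃ v w : V, Γ.Adj v w ∧
      r = FreeGroup.of v * FreeGroup.of w * (FreeGroup.of v)⁻¹ * (FreeGroup.of w)⁻¹})
      (FreeGroup.of v * FreeGroup.of w * (FreeGroup.of v)⁻¹ * (FreeGroup.of w)⁻¹) = 1 :=
    PresentedGroup.one_of_mem ⟨v, w, h, rfl⟩
  simp only [map_mul, map_inv] at this
  exact (commutatorElement_eq_one_iff_mul_comm (g₁ := gen Γ v) (g₂ := gen Γ w)).1 this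

theorem closure_gens : Subgroup.closure (gens Γ) = ⊤ :=
  PresentedGroup.closure_range_of _

/-! ### Words -/

variable (Γ) in
/-- The element represented by a letter. -/
def letter (l : V × Bool) : RAAG Γ := if l.2 then gen Γ l.1 else (gen Γ l.1)⁻¹

@[simp] theorem eval_nil : eval Γ [] = 1 := rfl

@[simp] theorem eval_cons (l : V × Bool) (w : List (V × Bool)) :
    eval Γ (l :: w) = letter Γ l * eval Γ w := by
  simp [eval, letter]

@[simp] theorem eval_append (w w' : List (V × Bool)) :
    eval Γ (w ++ w') = eval Γ w * eval Γ w' := by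
  simp [eval]

theorem letter_true (v : V) : letter Γ (v, true) = gen Γ v := rfl

theorem letter_false (v : V) : letter Γ (v, false) = (gen Γ v)⁻¹ := rfl

/-! ### Walls -/

variable (Γ) in
/-- The subgroup generated by the link of a vertex. -/
def linkSubgroup (v : V) : Subgroup (RAAG Γ) := Subgroup.closure (gen Γ '' Γ.neighborSet v)

variable (Γ) in
/-- The walls (hyperplanes) of the Cayley graph: a wall consists of a label `v` and a coset of the
link subgroup of `v`. -/
def Wall : Type _ := Σ v : V, RAAG Γ ⧸ linkSubgroup Γ v

/-- The label of a wall. -/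
def Wall.label (W : Wall Γ) : V := W.1

/-- The wall crossed by the edge from `x` to `x * letter l`. -/
def wallAt (x : RAAG Γ) (l : V × Bool) : Wall Γ :=
  ⟨l.1, ((if l.2 then x else x * (gen Γ l.1)⁻¹ : RAAG Γ) : RAAG Γ ⧸ linkSubgroup Γ l.1)⟩

@[simp] theorem label_wallAt (x : RAAG Γ) (l : V × Bool) : (wallAt x l).label = l.1 := rfl

theorem gen_mem_linkSubgroup {v w : V} (h : Γ.Adj v w) : gen Γ w ∈ linkSubgroup Γ v :=
  Subgroup.subset_closure ⟨w, h, rfl⟩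

theorem commute_of_mem_linkSubgroup {v : V} {x : RAAG Γ} (h : x ∈ linkSubgroup Γ v) :
    Commute (gen Γ v) x := by
  induction h using Subgroup.closure_induction with
  | mem x hx => obtain ⟨w, hw, rfl⟩ := hx; exact commute_gen hw
  | one => exact Commute.one_right _
  | mul x y _ _ hx hy => exact hx.mul_right hy
  | inv x _ hx => exact hx.inv_right

/-- Opposite edges of a square of commuting generators lie in one wall; this is what makes transport
around squares trivial. -/
theorem wallAt_mul_gen (x : RAAG Γ) {v w : V} (h : Γ.Adj v w) :
    wallAt (x * gen Γ w) (v, true) = wallAt x (v, true) := by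
  simp only [wallAt, if_true]
  congr 1
  rw [eq_comm, QuotientGroup.eq]
  simpa using gen_mem_linkSubgroup h

/-- Holonomy: labels of walls with values in a group, commuting whenever the vertices are adjacent,
integrate to a function on the group. -/
theorem exists_potential {P : Type*} [Group P] (h : Wall Γ → P)
    (hc : ∀ W W' : Wall Γ, Γ.Adj W.label W'.label → Commute (h W) (h W')) :
    ∃ F : RAAG Γ → P, ∀ x v, F (x * gen Γ v) = F x * h (wallAt x (v, true)) := by
  classical
  -- A generator moves the base point by right multiplication and the fibre by the weight of the
  -- wall crossed. Right multiplication reverses products, hence the opposite group below.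
  let e : V → Equiv.Perm (RAAG Γ × P) := fun v =>
    { toFun := fun q => (q.1 * gen Γ v, q.2 * h (wallAt q.1 (v, true)))
      invFun := fun q => (q.1 * (gen Γ v)⁻¹, q.2 * (h (wallAt (q.1 * (gen Γ v)⁻¹) (v, true)))⁻¹)
      left_inv := fun q => by simp
      right_inv := fun q => by simp }
  have he : ∀ v q, e v q = (q.1 * gen Γ v, q.2 * h (wallAt q.1 (v, true))) := fun _ _ => rfl
  let φ : RAAG Γ →* (Equiv.Perm (RAAG Γ × P))ᵐᵒᵖ := lift (fun v => MulOpposite.op (e v)) (by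
    intro v w hvw
    refine MulOpposite.unop_injective ?_
    simp only [MulOpposite.unop_mul, MulOpposite.unop_op]
    ext1 q
    simp only [Equiv.Perm.mul_apply, he, wallAt_mul_gen _ hvw, wallAt_mul_gen _ hvw.symm,
      mul_assoc, (commute_gen hvw).eq, (hc (wallAt q.1 (v, true)) (wallAt q.1 (w, true)) hvw).eq])
  have hφ : ∀ v, φ (gen Γ v) = MulOpposite.op (e v) := fun v => lift_gen _ _ v
  have h1 : ∀ x, ∀ y p, ((φ x).unop (y, p)).1 = y * x := by
    intro x
    have hx : x ∈ Subgroup.closure (gens Γ) := by rw [closure_gens]; trivial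
    induction hx using Subgroup.closure_induction with
    | mem x hx => obtain ⟨v, rfl⟩ := hx; intro y p; rw [hφ]; rfl
    | one => simp
    | mul x y _ _ hx hy =>
      intro z p
      simp only [map_mul, MulOpposite.unop_mul, Equiv.Perm.mul_apply]
      rw [← Prod.mk.eta (p := (φ x).unop (z, p)), hy, hx, mul_assoc]
    | inv x _ hx =>
      intro y p
      have := hx ((φ x⁻¹).unop (y, p)).1 ((φ x⁻¹).unop (y, p)).2
      rw [Prod.mk.eta, ← Equiv.Perm.mul_apply, ← MulOpposite.unop_mul, ← map_mul] at this
      simp only [inv_mul_cancel, map_one, MulOpposite.unop_one, Equiv.Perm.one_apply] at this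
      exact eq_mul_inv_of_mul_eq this.symm
  refine ⟨fun x => ((φ x).unop (1, 1)).2, fun x v => ?_⟩
  simp only [map_mul, MulOpposite.unop_mul, Equiv.Perm.mul_apply, hφ, MulOpposite.unop_op, he, h1,
    one_mul]

/-- The walls crossed by the path starting at `x` and reading the word `w`. -/
def walls : RAAG Γ → List (V × Bool) → List (Wall Γ)
  | _, [] => []
  | x, l :: w => wallAt x l :: walls (x * letter Γ l) w

@[simp] theorem walls_nil (x : RAAG Γ) : walls x [] = [] := rfl

@[simp] theorem walls_cons (x : RAAG Γ) (l : V × Bool) (w : List (V × Bool)) :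
    walls x (l :: w) = wallAt x l :: walls (x * letter Γ l) w := rfl

@[simp] theorem length_walls (x : RAAG Γ) (w : List (V × Bool)) :
    (walls x w).length = w.length := by
  induction w generalizing x with
  | nil => rfl
  | cons l w ih => simp [ih]

theorem map_label_walls (x : RAAG Γ) (w : List (V × Bool)) :
    (walls x w).map Wall.label = w.map Prod.fst := by
  induction w generalizing x with
  | nil => rfl
  | cons l w ih => simp [ih]

theorem exists_of_mem_walls {x : RAAG Γ} {w : List (V × Bool)} {W : Wall Γ} (h : W ∈ walls x w) :
    ∃ u l u', w = u ++ l :: u' ∧ wallAt (x * eval Γ u) l = W := by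
  induction w generalizing x with
  | nil => simp at h
  | cons l w ih =>
    rw [walls_cons, List.mem_cons] at h
    rcases h with rfl | h
    · exact ⟨[], l, w, rfl, by simp⟩
    · obtain ⟨u, l', u', rfl, rfl⟩ := ih h
      exact ⟨l :: u, l', u', rfl, by simp [mul_assoc]⟩

/-- Weights of order at most two make the direction of a crossing irrelevant. -/
theorem potential_eval {P : Type*} [Group P] {h : Wall Γ → P} {F : RAAG Γ → P}
    (hF : ∀ x v, F (x * gen Γ v) = F x * h (wallAt x (v, true))) (hh : ∀ W, h W * h W = 1)
    (x : RAAG Γ) (w : List (V × Bool)) :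
    F (x * eval Γ w) = F x * ((walls x w).map h).prod := by
  induction w generalizing x with
  | nil => simp
  | cons l w ih =>
    rw [eval_cons, ← mul_assoc, ih, walls_cons, List.map_cons, List.prod_cons, ← mul_assoc]
    congr 1
    obtain ⟨v, b⟩ := l
    cases b
    · have h1 := hF (x * (gen Γ v)⁻¹) v
      rw [inv_mul_cancel_right] at h1
      have h2 : wallAt x (v, false) = wallAt (x * (gen Γ v)⁻¹) (v, true) := rfl
      rw [letter_false, h1, h2, mul_assoc, hh, mul_one]
    · exact hF x v

/-! ### Reduced words -/

open Classical in
variable (Γ) in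
/-- The retraction onto the link subgroup of `v`. -/
noncomputable def linkRetraction (v : V) : RAAG Γ →* RAAG Γ :=
  lift (fun w => if Γ.Adj v w then gen Γ w else 1) (by
    intro u w h
    split_ifs
    · exact commute_gen h
    · exact Commute.one_right _
    · exact Commute.one_left _
    · exact Commute.one_left _)

theorem linkRetraction_of_mem {v : V} {x : RAAG Γ} (h : x ∈ linkSubgroup Γ v) :
    linkRetraction Γ v x = x := by
  induction h using Subgroup.closure_induction with
  | mem x hx =>
    obtain ⟨w, hw, rfl⟩ := hx
    rw [linkRetraction, lift_gen, if_pos (show Γ.Adj v w from hw)]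
  | one => simp
  | mul x y _ _ hx hy => simp [hx, hy]
  | inv x _ hx => simp [hx]

theorem linkRetraction_gen (v : V) : linkRetraction Γ v (gen Γ v) = 1 := by
  rw [linkRetraction, lift_gen, if_neg (by simp)]

theorem exists_eval_eq_linkRetraction (v : V) (w : List (V × Bool)) :
    ∃ u : List (V × Bool), u.length ≤ w.length ∧ eval Γ u = linkRetraction Γ v (eval Γ w) := by
  induction w with
  | nil => exact ⟨[], le_rfl, by simp⟩
  | cons l w ih =>
    obtain ⟨u, hu, he⟩ := ih
    by_cases hl : Γ.Adj v l.1
    · refine ⟨l :: u, by simpa using hu, ?_⟩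
      have h1 : linkRetraction Γ v (letter Γ l) = letter Γ l := by
        refine linkRetraction_of_mem ?_
        unfold letter
        split_ifs
        · exact gen_mem_linkSubgroup hl
        · exact inv_mem (gen_mem_linkSubgroup hl)
      simp [he, h1]
    · refine ⟨u, by simp; omega, ?_⟩
      have h1 : linkRetraction Γ v (letter Γ l) = 1 := by
        unfold letter
        split_ifs <;> simp [linkRetraction, lift_gen, hl]
      simp [he, h1]

/-- Equality of cosets puts `u`, possibly extended by one or both outer letters, into the link
subgroup of `v`. The retraction fixes that element and kills `v`, so it is spelled by at most
`u.length` letters. Opposite signs remove both outer letters, equal signs one of them. -/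
theorem exists_shorter_of_wallAt_eq {x : RAAG Γ} {l l' : V × Bool} {u : List (V × Bool)}
    (h : wallAt x l = wallAt (x * letter Γ l * eval Γ u) l') :
    ∃ u' : List (V × Bool), u'.length < u.length + 2 ∧
      eval Γ u' = letter Γ l * eval Γ u * letter Γ l' := by
  obtain ⟨v, b⟩ := l
  obtain ⟨v', b'⟩ := l'
  obtain rfl : v = v' := congrArg Wall.label h
  have h' := eq_of_heq (Sigma.mk.inj h).2
  rw [QuotientGroup.eq] at h'
  obtain ⟨r, hr, her⟩ := exists_eval_eq_linkRetraction (Γ := Γ) v u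
  cases b <;> cases b' <;> simp only [letter_true, letter_false, if_true,
    Bool.false_eq_true, if_false] at h' ⊢
  · have e : eval Γ u * (gen Γ v)⁻¹ = eval Γ r := by
      have := linkRetraction_of_mem (show eval Γ u * (gen Γ v)⁻¹ ∈ _ by
        convert h' using 1; group)
      rw [← this, map_mul, map_inv, linkRetraction_gen, her]; simp
    exact ⟨(v, false) :: r, by simp; omega, by rw [eval_cons, letter_false, mul_assoc, e]⟩
  · have hm : eval Γ u ∈ linkSubgroup Γ v := by convert h' using 1; group
    refine ⟨u, by omega, ?_⟩
    rw [mul_assoc, ← (commute_of_mem_linkSubgroup hm).eq]; simp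
  · have e : gen Γ v * eval Γ u * (gen Γ v)⁻¹ = eval Γ r := by
      have := linkRetraction_of_mem (show gen Γ v * eval Γ u * (gen Γ v)⁻¹ ∈ _ by
        convert h' using 1; group)
      rw [← this, map_mul, map_mul, map_inv, linkRetraction_gen, her]; simp
    exact ⟨r, by omega, e.symm⟩
  · have e : gen Γ v * eval Γ u = eval Γ r := by
      have := linkRetraction_of_mem (show gen Γ v * eval Γ u ∈ _ by
        convert h' using 1; group)
      rw [← this, map_mul, linkRetraction_gen, her]; simp
    exact ⟨r ++ [(v, true)], by simp; omega, by
      rw [e, eval_append, eval_cons, letter_true]; simp⟩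

/-- A word crossing a wall twice can be shortened. -/
theorem nodup_walls_or_exists_shorter (x : RAAG Γ) (w : List (V × Bool)) :
    (walls x w).Nodup ∨ ∃ w' : List (V × Bool), w'.length < w.length ∧ eval Γ w' = eval Γ w := by
  induction w generalizing x with
  | nil => exact Or.inl List.nodup_nil
  | cons l w ih =>
    rcases ih (x * letter Γ l) with h | ⟨w', hw', he⟩
    · by_cases hm : wallAt x l ∈ walls (x * letter Γ l) w
      · obtain ⟨u, l', u', rfl, hW⟩ := exists_of_mem_walls hm
        obtain ⟨r, hr, he⟩ := exists_shorter_of_wallAt_eq hW.symm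
        refine Or.inr ⟨r ++ u', by simp; omega, by simp [he, mul_assoc]⟩
      · exact Or.inl (List.nodup_cons.2 ⟨hm, h⟩)
    · exact Or.inr ⟨l :: w', by simpa using hw', by simp [he]⟩

theorem IsReduced.nodup_walls {w : List (V × Bool)} (h : IsReduced Γ w) (x : RAAG Γ) :
    (walls x w).Nodup := by
  rcases nodup_walls_or_exists_shorter x w with h' | ⟨w', hw', he⟩
  · exact h'
  · exact absurd (h w' he) (by omega)

/-! ### Separation by walls -/

-- The potential with sign holonomy along `W` alone; commutation is free in `ℤˣ`.
open Classical in
theorem exists_side (W : Wall Γ) : ∃ F : RAAG Γ → ℤˣ, ∀ x v,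
    F (x * gen Γ v) = F x * (if wallAt x (v, true) = W then -1 else 1) :=
  exists_potential (fun W' => if W' = W then -1 else 1) fun _ _ _ => Commute.all _ _

/-- The side of the wall `W` on which a vertex lies. -/
noncomputable def side (W : Wall Γ) : RAAG Γ → ℤˣ := (exists_side W).choose

open Classical in
theorem side_mul_eval (W : Wall Γ) (x : RAAG Γ) (w : List (V × Bool)) :
    side W (x * eval Γ w) = side W x * (-1) ^ (walls x w).count W := by
  rw [potential_eval (F := side W) (h := fun W' => if W' = W then -1 else 1)
    (exists_side W).choose_spec (fun W' => by split_ifs <;> simp) x w]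
  congr 1
  induction walls x w with
  | nil => simp
  | cons a l ih => by_cases h : a = W <;> simp [h, ih, pow_succ]

/-- The set of walls separating two vertices. -/
def Sep (x y : RAAG Γ) : Set (Wall Γ) := {W | side W x ≠ side W y}

theorem mem_sep {x y : RAAG Γ} {W : Wall Γ} : W ∈ Sep x y ↔ side W x ≠ side W y := Iff.rfl

theorem sep_subset_walls (x : RAAG Γ) (w : List (V × Bool)) :
    Sep x (x * eval Γ w) ⊆ {W | W ∈ walls x w} := by
  classical
  intro W hW
  by_contra h
  rw [mem_sep, side_mul_eval, List.count_eq_zero_of_not_mem h] at hW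
  simp at hW

/-- The side changes with the parity of the number of crossings, and here every wall met is crossed
exactly once. -/
theorem sep_eq_walls {x : RAAG Γ} {w : List (V × Bool)} (h : (walls x w).Nodup) :
    Sep x (x * eval Γ w) = {W | W ∈ walls x w} := by
  classical
  refine (sep_subset_walls x w).antisymm fun W hW => ?_
  rw [mem_sep, side_mul_eval, List.count_eq_one_of_mem h hW]
  intro h
  simp at h

theorem exists_isReduced (g : RAAG Γ) : ∃ w, eval Γ w = g ∧ IsReduced Γ w := by
  have h0 : ∃ w, eval Γ w = g := by
    have hx : g ∈ Subgroup.closure (gens Γ) := by rw [closure_gens]; trivial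
    induction hx using Subgroup.closure_induction'' with
    | mem x hx => obtain ⟨v, rfl⟩ := hx; exact ⟨[(v, true)], by simp [letter_true]⟩
    | inv_mem x hx => obtain ⟨v, rfl⟩ := hx; exact ⟨[(v, false)], by simp [letter_false]⟩
    | one => exact ⟨[], rfl⟩
    | mul x y _ _ hx hy =>
      obtain ⟨w, rfl⟩ := hx
      obtain ⟨w', rfl⟩ := hy
      exact ⟨w ++ w', by simp⟩
  have hS : ({w | eval Γ w = g} : Set (List (V × Bool))).Nonempty := h0
  obtain ⟨w, hw, hmin⟩ := WellFounded.has_min (measure (List.length (α := V × Bool))).wf _ hS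
  refine ⟨w, hw, fun w' hw' => ?_⟩
  exact not_lt.1 (hmin w' (hw'.trans hw))

/-! ### The distance -/

variable (Γ) in
/-- The combinatorial distance. -/
noncomputable def rdist (x y : RAAG Γ) : ℕ := (oneSkeleton Γ).dist x y

theorem oneSkeleton_adj_iff {x y : RAAG Γ} :
    (oneSkeleton Γ).Adj x y ↔ x ≠ y ∧ ∃ l, y = x * letter Γ l := by
  rw [oneSkeleton, SimpleGraph.mulCayley_adj']
  refine and_congr_right fun _ => ⟨?_, ?_⟩
  · rintro ⟨_, ⟨v, rfl⟩, h | h⟩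
    · exact ⟨(v, true), h.symm⟩
    · exact ⟨(v, false), eq_mul_inv_of_mul_eq h.symm⟩
  · rintro ⟨⟨v, b⟩, h⟩
    refine ⟨gen Γ v, ⟨v, rfl⟩, ?_⟩
    cases b
    · exact Or.inr (by rw [h, letter_false]; simp)
    · exact Or.inl h.symm

theorem exists_word_of_walk {x y : RAAG Γ} (p : (oneSkeleton Γ).Walk x y) :
    ∃ w, x * eval Γ w = y ∧ w.length = p.length := by
  induction p with
  | nil => exact ⟨[], by simp⟩
  | cons h p ih =>
    obtain ⟨w, hw, hl⟩ := ih
    obtain ⟨-, l, rfl⟩ := oneSkeleton_adj_iff.1 h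
    exact ⟨l :: w, by simp [← mul_assoc, hw], by simp [hl]⟩

theorem exists_walk_length_le (x : RAAG Γ) (w : List (V × Bool)) :
    ∃ p : (oneSkeleton Γ).Walk x (x * eval Γ w), p.length ≤ w.length := by
  induction w generalizing x with
  | nil => exact ⟨SimpleGraph.Walk.nil.copy rfl (by simp), by rw [SimpleGraph.Walk.length_copy]; rfl⟩
  | cons l w ih =>
    obtain ⟨p, hp⟩ := ih (x * letter Γ l)
    have e : x * letter Γ l * eval Γ w = x * eval Γ (l :: w) := by simp [mul_assoc]
    by_cases h : x = x * letter Γ l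
    · exact ⟨p.copy h.symm e, by simp; omega⟩
    · exact ⟨(p.copy rfl e).cons (oneSkeleton_adj_iff.2 ⟨h, l, rfl⟩), by simp; omega⟩

variable (Γ) in
theorem oneSkeleton_connected : (oneSkeleton Γ).Connected := by
  have : Nonempty (RAAG Γ) := ⟨1⟩
  refine SimpleGraph.Connected.mk fun x y => ?_
  obtain ⟨w, hw, -⟩ := exists_isReduced (x⁻¹ * y)
  obtain ⟨p, -⟩ := exists_walk_length_le x w
  exact ⟨p.copy rfl (by rw [hw]; group)⟩

theorem rdist_mul_eval_le (x : RAAG Γ) (w : List (V × Bool)) :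
    rdist Γ x (x * eval Γ w) ≤ w.length := by
  obtain ⟨p, hp⟩ := exists_walk_length_le x w
  exact (SimpleGraph.dist_le p).trans hp

theorem IsReduced.rdist_eq {w : List (V × Bool)} (h : IsReduced Γ w) (x : RAAG Γ) :
    rdist Γ x (x * eval Γ w) = w.length := by
  refine le_antisymm (rdist_mul_eval_le x w) ?_
  obtain ⟨p, hp⟩ := (oneSkeleton_connected Γ).exists_walk_length_eq_dist x (x * eval Γ w)
  obtain ⟨w', hw', hl⟩ := exists_word_of_walk p
  rw [rdist, ← hp, ← hl]
  exact h w' (mul_left_cancel hw')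

theorem isReduced_of_length_le {x : RAAG Γ} {w : List (V × Bool)}
    (h : w.length ≤ rdist Γ x (x * eval Γ w)) : IsReduced Γ w := fun w' hw' =>
  h.trans (hw' ▸ rdist_mul_eval_le x w')

theorem finite_sep (x y : RAAG Γ) : (Sep x y).Finite := by
  obtain ⟨w, hw, -⟩ := exists_isReduced (x⁻¹ * y)
  obtain rfl : x * eval Γ w = y := by rw [hw]; group
  exact (List.finite_toSet _).subset (sep_subset_walls x w)

theorem rdist_eq_ncard (x y : RAAG Γ) : rdist Γ x y = (Sep x y).ncard := by
  classical
  obtain ⟨w, hw, hr⟩ := exists_isReduced (x⁻¹ * y)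
  obtain rfl : x * eval Γ w = y := by rw [hw]; group
  rw [hr.rdist_eq, sep_eq_walls (hr.nodup_walls x), ← length_walls x w,
    ← List.toFinset_card_of_nodup (hr.nodup_walls x), ← Set.ncard_coe_finset]
  simp

/-- Walls with four nonempty quadrants have adjacent labels. -/
theorem adj_of_crossing {W₁ W₂ : Wall Γ} {a b c d : RAAG Γ}
    (h₁ : W₁ ∈ Sep a b ∧ W₂ ∉ Sep a b) (h₂ : W₂ ∈ Sep b d ∧ W₁ ∉ Sep b d)
    (h₃ : W₂ ∈ Sep a c ∧ W₁ ∉ Sep a c) (h₄ : W₁ ∈ Sep c d ∧ W₂ ∉ Sep c d) :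
    Γ.Adj W₁.label W₂.label := by
  classical
  by_contra hn
  have hne : W₁ ≠ W₂ := by rintro rfl; exact h₁.2 h₁.1
  -- If the labels were not adjacent, these non-commuting transpositions would be admissible
  -- weights. Comparing the potential at `d` along the routes through `b` and through `c` would then
  -- force them to commute.
  let s : Equiv.Perm (Fin 3) := Equiv.swap 0 1
  let t : Equiv.Perm (Fin 3) := Equiv.swap 1 2
  let h : Wall Γ → Equiv.Perm (Fin 3) := fun W => if W = W₁ then s else if W = W₂ then t else 1
  have e₁ : h W₁ = s := if_pos rfl
  have e₂ : h W₂ = t := by simp only [h, if_neg hne.symm, if_true]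
  have e₃ : ∀ W, W ≠ W₁ → W ≠ W₂ → h W = 1 := fun W h1 h2 => by
    simp only [h, if_neg h1, if_neg h2]
  obtain ⟨F, hF⟩ := exists_potential h (by
    intro W W' hW
    by_cases c1 : W = W₁
    · by_cases c2 : W' = W₂
      · subst c1 c2; exact absurd hW hn
      · by_cases c3 : W' = W₁
        · rw [c1, c3]; exact Commute.refl _
        · rw [e₃ W' c3 c2]; exact Commute.one_right _
    · by_cases c2 : W = W₂
      · by_cases c3 : W' = W₁
        · subst c2 c3; exact absurd hW.symm hn
        · by_cases c4 : W' = W₂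
          · rw [c2, c4]; exact Commute.refl _
          · rw [e₃ W' c3 c4]; exact Commute.one_right _
      · rw [e₃ W c1 c2]; exact Commute.one_left _)
  have hh : ∀ W, h W * h W = 1 := by
    intro W
    simp only [h]
    split_ifs <;> simp [s, t]
  have prod_eq : ∀ (l : List (Wall Γ)) (W : Wall Γ), l.Nodup → W ∈ l →
      (∀ W' ∈ l, W' ≠ W → h W' = 1) → (l.map h).prod = h W := by
    intro l W hnd hm ho
    rw [List.prod_map_eq_pow_single W h ?_, List.count_eq_one_of_mem hnd hm, pow_one]
    exact fun W' hW' hl => ho W' hl hW'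
  have key : ∀ (x y : RAAG Γ) (W W' : Wall Γ), W ∈ Sep x y → W' ∉ Sep x y →
      (∀ U, U ≠ W → U ≠ W' → h U = 1) → F y = F x * h W := by
    intro x y W W' hW hW' ho
    obtain ⟨w, hw, hr⟩ := exists_isReduced (x⁻¹ * y)
    obtain rfl : x * eval Γ w = y := by rw [hw]; group
    rw [sep_eq_walls (hr.nodup_walls x)] at hW hW'
    rw [potential_eval hF hh, prod_eq _ W (hr.nodup_walls x) hW fun U hU hne =>
      ho U hne fun hU' => hW' (hU' ▸ hU)]
  have k₁ := key a b W₁ W₂ h₁.1 h₁.2 e₃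
  have k₂ := key b d W₂ W₁ h₂.1 h₂.2 fun U h1 h2 => e₃ U h2 h1
  have k₃ := key a c W₂ W₁ h₃.1 h₃.2 fun U h1 h2 => e₃ U h2 h1
  have k₄ := key c d W₁ W₂ h₄.1 h₄.2 e₃
  rw [k₂, k₁, k₃, mul_assoc, mul_assoc, mul_right_inj, e₁, e₂] at k₄
  exact absurd k₄ (by decide)

/-! ### Betweenness and medians -/

/-- The vertex `x` lies on the positive side of the wall `W`. -/
def IsPos (W : Wall Γ) (x : RAAG Γ) : Prop := side W x = 1

/-- Makes separation propositional: claims about one wall and finitely many vertices become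
tautologies for `tauto` and `grind`. -/
theorem mem_sep_iff {W : Wall Γ} {x y : RAAG Γ} : W ∈ Sep x y ↔ ¬(IsPos W x ↔ IsPos W y) := by
  rw [mem_sep, IsPos, IsPos]
  rcases Int.units_eq_one_or (side W x) with h | h <;>
    rcases Int.units_eq_one_or (side W y) with h' | h' <;> simp [h, h']

/-- The vertex `m` lies on a geodesic from `a` to `b`. -/
def Btw (a m b : RAAG Γ) : Prop := ∀ W : Wall Γ, ¬(W ∈ Sep a m ∧ W ∈ Sep m b)

/-- The vertex `m` lies on the same side of every wall as the majority of `a`, `b`, `c`. -/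
def IsMedian (m a b c : RAAG Γ) : Prop := Btw a m b ∧ Btw b m c ∧ Btw a m c

theorem rdist_comm (x y : RAAG Γ) : rdist Γ x y = rdist Γ y x := SimpleGraph.dist_comm

theorem rdist_triangle (x y z : RAAG Γ) : rdist Γ x z ≤ rdist Γ x y + rdist Γ y z :=
  (oneSkeleton_connected Γ).dist_triangle

theorem rdist_self (x : RAAG Γ) : rdist Γ x x = 0 := SimpleGraph.dist_self

theorem rdist_eq_zero_iff {x y : RAAG Γ} : rdist Γ x y = 0 ↔ x = y :=
  (oneSkeleton_connected Γ).dist_eq_zero_iff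

theorem eq_of_sep_eq_empty {x y : RAAG Γ} (h : ∀ W, W ∉ Sep x y) : x = y := by
  rw [← rdist_eq_zero_iff, rdist_eq_ncard, Set.eq_empty_of_forall_notMem h, Set.ncard_empty]

/-- `Sep a b` is the symmetric difference of `Sep a m` and `Sep m b`, so additivity of distances
means that these two sets are disjoint. -/
theorem btw_iff {a m b : RAAG Γ} : Btw a m b ↔ rdist Γ a m + rdist Γ m b = rdist Γ a b := by
  have fu : (Sep a m ∪ Sep m b).Finite := (finite_sep a m).union (finite_sep m b)
  have key := Set.ncard_union_add_ncard_inter (Sep a m) (Sep m b) (finite_sep a m) (finite_sep m b)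
  simp only [rdist_eq_ncard]
  constructor
  · intro h
    have h1 : Sep a m ∩ Sep m b = ∅ := Set.eq_empty_of_forall_notMem h
    have h2 : Sep a b = Sep a m ∪ Sep m b := by
      ext W
      have := h W
      simp only [Set.mem_union, mem_sep_iff] at this ⊢
      tauto
    rw [h1, Set.ncard_empty] at key
    rw [h2]; omega
  · intro h W hW
    have h1 : Sep a b ⊂ Sep a m ∪ Sep m b := by
      refine ⟨fun U hU => ?_, fun hs => ?_⟩
      · simp only [Set.mem_union, mem_sep_iff] at hU ⊢
        tauto
      · have := hs (Or.inl hW.1)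
        simp only [mem_sep_iff] at this hW
        tauto
    have h2 := Set.ncard_lt_ncard h1 fu
    have h3 : 0 < (Sep a m ∩ Sep m b).ncard :=
      (Set.ncard_pos (fu.subset fun U hU => Or.inl hU.1)).2 ⟨W, hW⟩
    omega

theorem sep_mul_letter (x : RAAG Γ) (l : V × Bool) : Sep x (x * letter Γ l) = {wallAt x l} := by
  have := sep_eq_walls (x := x) (w := [l]) (by simp)
  simpa using this

theorem mem_sep_mul_letter {x : RAAG Γ} {l : V × Bool} {W : Wall Γ} :
    W ∈ Sep x (x * letter Γ l) ↔ W = wallAt x l := by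
  rw [sep_mul_letter]; rfl

theorem rdist_mul_letter (x : RAAG Γ) (l : V × Bool) : rdist Γ x (x * letter Γ l) = 1 := by
  rw [rdist_eq_ncard, sep_mul_letter, Set.ncard_singleton]

theorem exists_letter {x y : RAAG Γ} (h : x ≠ y) : ∃ l, wallAt x l ∈ Sep x y := by
  obtain ⟨w, hw, hr⟩ := exists_isReduced (x⁻¹ * y)
  obtain rfl : x * eval Γ w = y := by rw [hw]; group
  cases w with
  | nil => simp at h
  | cons l w =>
    refine ⟨l, ?_⟩
    rw [sep_eq_walls (hr.nodup_walls x)]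
    simp

/-- The first wall in the set `Q` crossed by a geodesic. -/
theorem exists_first_wall (Q : Set (Wall Γ)) (x y : RAAG Γ) :
    (∀ W ∈ Sep x y, W ∉ Q) ∨ ∃ r l, wallAt r l ∈ Q ∧ wallAt r l ∈ Sep r y ∧ Btw x r y ∧
      ∀ U ∈ Sep x r, U ∉ Q := by
  induction hn : rdist Γ x y generalizing x with
  | zero =>
    left
    rw [rdist_eq_zero_iff] at hn
    subst hn
    intro W hW
    simp [mem_sep_iff] at hW
  | succ n ih =>
    obtain ⟨l, hl⟩ := exists_letter (x := x) (y := y) (by rintro rfl; simp [rdist_self] at hn)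
    by_cases hQ : wallAt x l ∈ Q
    · refine Or.inr ⟨x, l, hQ, hl, ?_, ?_⟩
      · intro W; simp [mem_sep_iff]
      · intro W; simp [mem_sep_iff]
    have hs : ∀ W, W ∈ Sep x (x * letter Γ l) ↔ W = wallAt x l := fun W => mem_sep_mul_letter
    have hb : Btw x (x * letter Γ l) y := by
      rintro W ⟨h1, h2⟩
      rw [hs] at h1
      subst h1
      have := (hs (wallAt x l)).2 rfl
      simp only [mem_sep_iff] at *
      tauto
    have hd := btw_iff.1 hb
    rw [rdist_mul_letter] at hd
    rcases ih (x * letter Γ l) (by omega) with h | ⟨r, l', h1, h2, h3, h4⟩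
    · left
      intro W hW hWQ
      by_cases hWl : W ∈ Sep x (x * letter Γ l)
      · rw [(hs W).1 hWl] at hWQ; exact hQ hWQ
      · refine h W ?_ hWQ
        simp only [mem_sep_iff] at *
        tauto
    · refine Or.inr ⟨r, l', h1, h2, ?_, ?_⟩
      · intro W hW
        have e1 := hb W
        have e2 := h3 W
        simp only [mem_sep_iff] at e1 e2 hW
        tauto
      · intro U hU hUQ
        by_cases hUl : U ∈ Sep x (x * letter Γ l)
        · rw [(hs U).1 hUl] at hUQ; exact hQ hUQ
        · refine h4 U ?_ hUQ
          simp only [mem_sep_iff] at *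
          tauto

/-! ### Walls next to a vertex, and existence of medians -/

theorem eval_mem_linkSubgroup {v : V} {w : List (V × Bool)} (h : ∀ l ∈ w, Γ.Adj v l.1) :
    eval Γ w ∈ linkSubgroup Γ v := by
  induction w with
  | nil => exact one_mem _
  | cons l w ih =>
    rw [eval_cons]
    refine mul_mem ?_ (ih fun l' hl' => h l' (List.mem_cons_of_mem _ hl'))
    have hl := h l List.mem_cons_self
    unfold letter
    split_ifs
    · exact gen_mem_linkSubgroup hl
    · exact inv_mem (gen_mem_linkSubgroup hl)

theorem label_mem_of_mem {m : RAAG Γ} {w : List (V × Bool)} (hr : IsReduced Γ w) {l : V × Bool}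
    (hl : l ∈ w) : ∃ W ∈ Sep m (m * eval Γ w), W.label = l.1 := by
  have : l.1 ∈ (walls m w).map Wall.label := by
    rw [map_label_walls]; exact List.mem_map_of_mem hl
  obtain ⟨W, hW, he⟩ := List.mem_map.1 this
  refine ⟨W, ?_, he⟩
  rw [sep_eq_walls (hr.nodup_walls m)]
  exact hW

/-- A geodesic from `x` to `y` uses only letters from the link, so the coset does not change; for an
inverse letter, conjugation by the generator fixes the link subgroup pointwise. -/
theorem wallAt_eq_of_adj {x y : RAAG Γ} {l : V × Bool} (h : ∀ U ∈ Sep x y, Γ.Adj l.1 U.label) :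
    wallAt x l = wallAt y l := by
  obtain ⟨w, hw, hr⟩ := exists_isReduced (x⁻¹ * y)
  obtain rfl : x * eval Γ w = y := by rw [hw]; group
  have hm : eval Γ w ∈ linkSubgroup Γ l.1 := eval_mem_linkSubgroup fun l' hl' => by
    obtain ⟨W, hW, he⟩ := label_mem_of_mem (m := x) hr hl'
    exact he ▸ h W hW
  obtain ⟨v, b⟩ := l
  unfold wallAt
  congr 1
  rw [QuotientGroup.eq]
  cases b
  · have : gen Γ v * eval Γ w * (gen Γ v)⁻¹ = eval Γ w := by
      rw [(commute_of_mem_linkSubgroup hm).eq]; simp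
    convert hm using 1
    simp only [Bool.false_eq_true, if_false]
    rw [mul_inv_rev, inv_inv, ← mul_assoc, mul_assoc _ x⁻¹, inv_mul_cancel_left]
    exact this
  · simpa using hm

/-- If some wall separates `m` from both `x` and `y`, then there is such a wall adjacent to `m`. -/
theorem exists_letter_of_mem_sep {m x y : RAAG Γ} {W : Wall Γ} (hx : W ∈ Sep m x)
    (hy : W ∈ Sep m y) : ∃ l, wallAt m l ∈ Sep m x ∧ wallAt m l ∈ Sep m y := by
  -- Take the first wall towards `y` that separates `m` from `x`. The walls met before it do not,
  -- hence they cross it, and the crossing edge can be slid back to `m`.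
  rcases exists_first_wall (Sep m x) m y with h | ⟨r, l, h1, h2, h3, h4⟩
  · exact absurd hx (h W hy)
  have hl : wallAt r l ∉ Sep m r := fun h => h4 _ h h1
  have e : wallAt m l = wallAt r l := by
    refine wallAt_eq_of_adj fun U hU => ?_
    have hU' := h4 U hU
    have hb := h3 U
    change Γ.Adj (wallAt r l).label U.label
    refine (adj_of_crossing (a := m) (b := r) (c := x) (d := y) (W₁ := U) (W₂ := wallAt r l)
      ⟨hU, hl⟩ ⟨h2, ?_⟩ ⟨h1, hU'⟩ ⟨?_, ?_⟩).symm
    all_goals grind [mem_sep_iff]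
  refine ⟨l, e ▸ h1, e ▸ ?_⟩
  grind [mem_sep_iff]

theorem rdist_mul_letter_of_mem {m x : RAAG Γ} {l : V × Bool} (h : wallAt m l ∈ Sep m x) :
    1 + rdist Γ (m * letter Γ l) x = rdist Γ m x := by
  rw [← rdist_mul_letter m l]
  refine btw_iff.1 fun W hW => ?_
  obtain ⟨h1, h2⟩ := hW
  have h3 := h1
  rw [mem_sep_mul_letter] at h1
  subst h1
  grind [mem_sep_iff]

/-- Minimise the sum of the three distances. If a wall separated `m` from two of the points, one
step would approach both and recede from the third by at most one. -/
theorem exists_isMedian (a b c : RAAG Γ) : ∃ m, IsMedian m a b c := by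
  obtain ⟨m, -, hmin⟩ := WellFounded.has_min
    (measure fun m => rdist Γ m a + rdist Γ m b + rdist Γ m c).wf Set.univ ⟨1, trivial⟩
  have hmin' : ∀ m', ¬(rdist Γ m' a + rdist Γ m' b + rdist Γ m' c <
    rdist Γ m a + rdist Γ m b + rdist Γ m c) := fun m' => hmin m' trivial
  have key : ∀ x y z, (∀ m', ¬(rdist Γ m' x + rdist Γ m' y + rdist Γ m' z <
      rdist Γ m x + rdist Γ m y + rdist Γ m z)) → Btw x m y := by
    intro x y z h W hW
    obtain ⟨l, hx, hy⟩ := exists_letter_of_mem_sep (m := m) (x := x) (y := y) (W := W)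
      (by have := hW.1; grind [mem_sep_iff]) hW.2
    apply h (m * letter Γ l)
    have h1 := rdist_mul_letter_of_mem hx
    have h2 := rdist_mul_letter_of_mem hy
    have h3 := rdist_triangle (m * letter Γ l) m z
    rw [rdist_comm _ m, rdist_mul_letter] at h3
    omega
  refine ⟨m, key a b c hmin', key b c a fun m' => ?_, key a c b fun m' => ?_⟩
  · have := hmin' m'; omega
  · have := hmin' m'; omega

/-! ### Join-busting pairs of vertices -/

/-- Along geodesics from `a` to `b`, subpaths whose labels lie in a join have length at most `N`. -/
def JoinBustingPair (N : ℕ) (a b : RAAG Γ) : Prop :=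
  ∀ m n, Btw a m b → Btw m n b → ∀ J, IsJoin Γ J → (∀ W ∈ Sep m n, W.label ∈ J) →
    rdist Γ m n ≤ N

/-- Reduced words for the three legs concatenate to a reduced word, because their lengths add up to
the distance. -/
theorem IsJoinBusting.joinBustingPair {N : ℕ} {a b : RAAG Γ} (h : IsJoinBusting Γ N (a⁻¹ * b)) :
    JoinBustingPair N a b := by
  intro m n hm hn J hJ hl
  obtain ⟨w₁, e₁, h₁⟩ := exists_isReduced (a⁻¹ * m)
  obtain ⟨w₂, e₂, h₂⟩ := exists_isReduced (m⁻¹ * n)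
  obtain ⟨w₃, e₃, h₃⟩ := exists_isReduced (n⁻¹ * b)
  obtain rfl : a * eval Γ w₁ = m := by rw [e₁]; group
  obtain rfl : a * eval Γ w₁ * eval Γ w₂ = n := by rw [e₂]; group
  obtain rfl : a * eval Γ w₁ * eval Γ w₂ * eval Γ w₃ = b := by rw [e₃]; group
  have d₁ := btw_iff.1 hm
  have d₂ := btw_iff.1 hn
  rw [h₁.rdist_eq] at d₁
  rw [h₂.rdist_eq, h₃.rdist_eq] at d₂
  have hw : IsReduced Γ (w₁ ++ w₂ ++ w₃) := by
    refine isReduced_of_length_le (x := a) ?_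
    simp only [eval_append, List.length_append, ← mul_assoc]
    omega
  have := h (w₁ ++ w₂ ++ w₃) (by simp [mul_assoc]) hw w₂ ⟨w₁, w₃, rfl⟩ ⟨J, hJ, fun l hl' => by
    obtain ⟨W, hW, he⟩ := label_mem_of_mem (m := a * eval Γ w₁) h₂ hl'
    exact he ▸ hl W hW⟩
  have e := h₂.rdist_eq 1
  rw [one_mul] at e
  rw [h₂.rdist_eq, ← e]
  exact this

/-- The join is `v` with its link; a wall between `m` and `n` witnesses that the link is nonempty.
-/
theorem JoinBustingPair.rdist_le_of_link {N : ℕ} {a b m n : RAAG Γ} (h : JoinBustingPair N a b)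
    (hm : Btw a m b) (hn : Btw m n b) (v : V) (hv : ∀ W ∈ Sep m n, Γ.Adj v W.label) :
    rdist Γ m n ≤ N := by
  by_cases he : ∃ W, W ∈ Sep m n
  · obtain ⟨W, hW⟩ := he
    exact h m n hm hn _ ⟨{v}, Γ.neighborSet v, ⟨v, rfl⟩, ⟨_, hv W hW⟩, rfl,
      by rintro _ rfl w hw; exact hw⟩ fun U hU => Or.inr (hv U hU)
  · push Not at he
    rw [eq_of_sep_eq_empty he, rdist_self]
    exact Nat.zero_le _

/-- Cutting at the at most `C` exceptional edges leaves at most `C + 1` pieces governed by the link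
of `v`, each of length at most `N`. -/
theorem JoinBustingPair.rdist_le_of_ncard_le {N : ℕ} {a b n : RAAG Γ}
    (h : JoinBustingPair N a b) (v : V) (C : ℕ) {m : RAAG Γ} (hm : Btw a m b) (hn : Btw m n b)
    (hC : {W ∈ Sep m n | ¬Γ.Adj v W.label}.ncard ≤ C) : rdist Γ m n ≤ C * (N + 1) + N := by
  induction C generalizing m with
  | zero =>
    have h0 : {W ∈ Sep m n | ¬Γ.Adj v W.label} = ∅ :=
      (Set.ncard_eq_zero ((finite_sep m n).subset fun W hW => hW.1)).1 (by omega)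
    have := h.rdist_le_of_link hm hn v fun W hW => by
      by_contra hc
      exact Set.eq_empty_iff_forall_notMem.1 h0 W ⟨hW, hc⟩
    omega
  | succ C ih =>
    rcases exists_first_wall {W | ¬Γ.Adj v W.label} m n with hg | ⟨r, l, h1, h2, h3, h4⟩
    · have := h.rdist_le_of_link hm hn v fun W hW => not_not.1 (hg W hW)
      exact this.trans (Nat.le_add_left _ _)
    have hlet : ∀ W, W ∈ Sep r (r * letter Γ l) ↔ W = wallAt r l := fun W => mem_sep_mul_letter
    have hmr : Btw m r b := fun W hW => by
      have a1 := hn W; have a2 := h3 W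
      grind [mem_sep_iff]
    have d1 : rdist Γ m r ≤ N := h.rdist_le_of_link hm hmr v fun W hW => not_not.1 (h4 W hW)
    have hr' : ∀ W, ¬(W ∈ Sep r (r * letter Γ l) ∧ W ∈ Sep (r * letter Γ l) n) := by
      rintro W ⟨c1, c2⟩
      obtain rfl := (hlet W).1 c1
      grind [mem_sep_iff]
    have d2 : rdist Γ (r * letter Γ l) n ≤ C * (N + 1) + N := by
      refine ih ?_ ?_ ?_
      · intro W hW
        have a1 := hn W; have a2 := h3 W; have a3 := hr' W; have a4 := hm W
        grind [mem_sep_iff]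
      · intro W hW
        have a1 := hn W; have a2 := h3 W; have a3 := hr' W
        grind [mem_sep_iff]
      · refine Nat.le_of_lt_succ (lt_of_lt_of_le (Set.ncard_lt_ncard ⟨?_, ?_⟩
          ((finite_sep m n).subset fun W hW => hW.1)) hC)
        · rintro W ⟨c1, c2⟩
          refine ⟨?_, c2⟩
          have a2 := h3 W; have a3 := hr' W
          grind [mem_sep_iff]
        · intro hs
          have a3 := hr' (wallAt r l)
          have a2 := h3 (wallAt r l)
          have a4 := (hlet (wallAt r l)).2 rfl
          have := (hs ⟨by grind [mem_sep_iff], h1⟩).1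
          grind [mem_sep_iff]
    have t1 := rdist_triangle m r n
    have t2 := rdist_triangle r (r * letter Γ l) n
    rw [rdist_mul_letter] at t2
    rw [add_mul]
    omega

/-- Projection to the interval between the vertices of a join-busting pair is contracting. -/
theorem JoinBustingPair.contraction {N : ℕ} {a b x y m n : RAAG Γ} (h : JoinBustingPair N a b)
    (hm : IsMedian m a b x) (hn : IsMedian n a b y) :
    rdist Γ m n ≤ 2 * N ∨ rdist Γ x y = rdist Γ x m + rdist Γ m n + rdist Γ n y := by
  obtain ⟨hm1, hm2, hm3⟩ := hm
  obtain ⟨hn1, hn2, hn3⟩ := hn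
  by_cases hW : ∃ W, W ∈ Sep x m ∧ W ∈ Sep n y
  · left
    obtain ⟨W, hWx, hWy⟩ := hW
    have hWab : W ∉ Sep m n ∧ W ∉ Sep x y := by
      have a1 := hm1 W; have a2 := hm2 W; have a3 := hm3 W
      have b1 := hn1 W; have b2 := hn2 W; have b3 := hn3 W
      grind [mem_sep_iff]
    have hadj : ∀ U ∈ Sep m n, Γ.Adj W.label U.label := by
      intro U hU
      have a1 := hm1 U; have a2 := hm2 U; have a3 := hm3 U
      have b1 := hn1 U; have b2 := hn2 U; have b3 := hn3 U
      refine adj_of_crossing (a := m) (b := x) (c := n) (d := y) ⟨?_, ?_⟩ ⟨?_, ?_⟩ ⟨?_, ?_⟩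
        ⟨?_, ?_⟩
      all_goals grind [mem_sep_iff]
    -- `m` and `n` need not lie on a common geodesic from `a` to `b`, but the legs from `k` to each
    -- of them extend to such geodesics; hence the factor 2.
    obtain ⟨k, hk1, hk2, hk3⟩ := exists_isMedian a m n
    have d1 : rdist Γ k m ≤ N := by
      refine h.rdist_le_of_link ?_ ?_ W.label fun U hU => hadj U ?_
      · intro U
        have a1 := hm1 U; have c1 := hk1 U; have c2 := hk2 U; have c3 := hk3 U
        grind [mem_sep_iff]
      · intro U
        have a1 := hm1 U; have c1 := hk1 U; have c2 := hk2 U; have c3 := hk3 U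
        grind [mem_sep_iff]
      · have c2 := hk2 U
        grind [mem_sep_iff]
    have d2 : rdist Γ k n ≤ N := by
      refine h.rdist_le_of_link ?_ ?_ W.label fun U hU => hadj U ?_
      · intro U
        have a1 := hn1 U; have c1 := hk1 U; have c2 := hk2 U; have c3 := hk3 U
        grind [mem_sep_iff]
      · intro U
        have a1 := hn1 U; have c1 := hk1 U; have c2 := hk2 U; have c3 := hk3 U
        grind [mem_sep_iff]
      · have c2 := hk2 U
        grind [mem_sep_iff]
    have t := rdist_triangle m k n
    rw [rdist_comm m k] at t
    omega
  · right
    push Not at hW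
    have e1 : Btw x m n := fun U hU => by
      have a1 := hm1 U; have a2 := hm2 U; have a3 := hm3 U
      have b1 := hn1 U; have b2 := hn2 U; have b3 := hn3 U
      grind [mem_sep_iff]
    have e2 : Btw x n y := fun U hU => by
      have a1 := hm1 U; have a2 := hm2 U; have a3 := hm3 U
      have b1 := hn1 U; have b2 := hn2 U; have b3 := hn3 U
      have c := hW U
      grind [mem_sep_iff]
    rw [← btw_iff.1 e2, ← btw_iff.1 e1]

/-- Projection to an interval does not increase distances. -/
theorem IsMedian.rdist_le {a b x y m n : RAAG Γ} (hm : IsMedian m a b x) (hn : IsMedian n a b y) :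
    rdist Γ m n ≤ rdist Γ x y := by
  rw [rdist_eq_ncard, rdist_eq_ncard]
  refine Set.ncard_le_ncard (fun U hU => ?_) (finite_sep x y)
  obtain ⟨hm1, hm2, hm3⟩ := hm
  obtain ⟨hn1, hn2, hn3⟩ := hn
  have a1 := hm1 U; have a2 := hm2 U; have a3 := hm3 U
  have b1 := hn1 U; have b2 := hn2 U; have b3 := hn3 U
  grind [mem_sep_iff]

/-- Intervals of join-busting pairs are thin. -/
theorem JoinBustingPair.rdist_le_of_btw {N : ℕ} {a b y z : RAAG Γ} (h : JoinBustingPair N a b)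
    (hy : Btw a y b) (hz : Btw a z b) : rdist Γ y z ≤ 2 * N ∨
      rdist Γ a y + rdist Γ y z = rdist Γ a z ∨ rdist Γ a z + rdist Γ y z = rdist Γ a y := by
  obtain ⟨k, hk1, hk2, hk3⟩ := exists_isMedian a y z
  -- The quadrants are occupied by `k`, `y`, `z` and `b`. Unless one family of walls is empty, the
  -- two families span a join.
  have cross : ∀ W₁ ∈ Sep k y, ∀ W₂ ∈ Sep k z, Γ.Adj W₁.label W₂.label := by
    intro W₁ h₁ W₂ h₂
    have a1 := hy W₁; have a2 := hz W₁; have c1 := hk1 W₁; have c2 := hk2 W₁; have c3 := hk3 W₁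
    have b1 := hy W₂; have b2 := hz W₂; have d1 := hk1 W₂; have d2 := hk2 W₂; have d3 := hk3 W₂
    refine adj_of_crossing (a := k) (b := y) (c := z) (d := b) ⟨?_, ?_⟩ ⟨?_, ?_⟩ ⟨?_, ?_⟩
        ⟨?_, ?_⟩
    all_goals grind [mem_sep_iff]
  by_cases ey : k = y
  · subst ey
    exact Or.inr (Or.inl (btw_iff.1 hk3))
  by_cases ez : k = z
  · subst ez
    rw [rdist_comm y k]
    exact Or.inr (Or.inr (btw_iff.1 hk1))
  left
  have ny : ∃ W, W ∈ Sep k y := by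
    by_contra hc; push Not at hc; exact ey (eq_of_sep_eq_empty hc)
  have nz : ∃ W, W ∈ Sep k z := by
    by_contra hc; push Not at hc; exact ez (eq_of_sep_eq_empty hc)
  have hJ : IsJoin Γ (Wall.label '' Sep k y ∪ Wall.label '' Sep k z) := by
    refine ⟨_, _, Set.Nonempty.image _ ny, Set.Nonempty.image _ nz, rfl, ?_⟩
    rintro _ ⟨W₁, h₁, rfl⟩ _ ⟨W₂, h₂, rfl⟩
    exact cross W₁ h₁ W₂ h₂
  have d1 : rdist Γ k y ≤ N := by
    refine h k y ?_ ?_ _ hJ fun W hW => Or.inl ⟨W, hW, rfl⟩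
    all_goals
      intro U
      have a1 := hy U; have c1 := hk1 U; have c2 := hk2 U; have c3 := hk3 U
      grind [mem_sep_iff]
  have d2 : rdist Γ k z ≤ N := by
    refine h k z ?_ ?_ _ hJ fun W hW => Or.inr ⟨W, hW, rfl⟩
    all_goals
      intro U
      have a1 := hz U; have c1 := hk1 U; have c2 := hk2 U; have c3 := hk3 U
      grind [mem_sep_iff]
  have t := rdist_triangle y k z
  rw [rdist_comm y k] at t
  omega

/-- Suppose that the vertices `z` and `q` are on the same side of the wall `W` and adjacent to it.
If `z` lies on a geodesic from `a` to `b` and `W` separates `a` from `b`, then `z` is close to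
every vertex near `q` which forms a join-busting pair with `a`. -/
theorem JoinBustingPair.rdist_le_of_common_wall {N C : ℕ} {a b x z z' q q' : RAAG Γ} {W : Wall Γ}
    (h : JoinBustingPair N a b) (hx : JoinBustingPair N a x) (hz : Btw a z b)
    (hzz : ∀ U, U ∈ Sep z z' ↔ U = W) (hqq : ∀ U, U ∈ Sep q q' ↔ U = W) (hzq : W ∉ Sep z q)
    (hC : rdist Γ q x ≤ C) : rdist Γ z x ≤ 3 * (C * (N + 1) + N) := by
  have cross : ∀ U ∈ Sep z q, Γ.Adj W.label U.label := by
    intro U hU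
    have hne : U ≠ W := by rintro rfl; exact hzq hU
    have a1 : U ∉ Sep z z' := fun hc => hne ((hzz U).1 hc)
    have a2 : U ∉ Sep q q' := fun hc => hne ((hqq U).1 hc)
    have a3 := (hzz W).2 rfl
    have a4 := (hqq W).2 rfl
    refine adj_of_crossing (a := z) (b := z') (c := q) (d := q') ⟨a3, a1⟩ ⟨?_, ?_⟩ ⟨hU, hzq⟩
      ⟨a4, a2⟩
    all_goals
      clear hzz hqq
      grind [mem_sep_iff]
  -- Walls between `z` and `q` have labels adjacent to that of `W`, so exceptions must separate `q`
  -- from `x`, and there are at most `C` of those.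
  have bad : ∀ {m n : RAAG Γ}, Sep m n ⊆ Sep z x →
      {U ∈ Sep m n | ¬Γ.Adj W.label U.label}.ncard ≤ C := by
    intro m n hs
    rw [rdist_eq_ncard] at hC
    refine (Set.ncard_le_ncard ?_ (finite_sep q x)).trans hC
    rintro U ⟨h1, h2⟩
    have h3 := hs h1
    have h4 : U ∉ Sep z q := fun hc => h2 (cross U hc)
    grind [mem_sep_iff]
  -- Join `z` to `x` through `k` and `m`: the leg at `x` lies on a geodesic from `a` to `x`, the
  -- other two on geodesics from `a` to `b`.
  obtain ⟨m, hm1, hm2, hm3⟩ := exists_isMedian a b x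
  have d1 : rdist Γ m x ≤ C * (N + 1) + N := by
    refine hx.rdist_le_of_ncard_le W.label C hm3 (fun U hU => ?_) (bad fun U hU => ?_)
    · simp [mem_sep_iff] at hU
    · have a1 := hm1 U; have a2 := hm2 U; have a3 := hm3 U; have a4 := hz U
      grind [mem_sep_iff]
  obtain ⟨k, hk1, hk2, hk3⟩ := exists_isMedian a m z
  have d2 : rdist Γ k m ≤ C * (N + 1) + N := by
    refine h.rdist_le_of_ncard_le W.label C ?_ ?_ (bad ?_)
    all_goals
      intro U
      have a1 := hm1 U; have a2 := hm2 U; have a3 := hm3 U; have a4 := hz U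
      have c1 := hk1 U; have c2 := hk2 U; have c3 := hk3 U
      grind [mem_sep_iff]
  have d3 : rdist Γ k z ≤ C * (N + 1) + N := by
    refine h.rdist_le_of_ncard_le W.label C ?_ ?_ (bad ?_)
    all_goals
      intro U
      have a1 := hm1 U; have a2 := hm2 U; have a3 := hm3 U; have a4 := hz U
      have c1 := hk1 U; have c2 := hk2 U; have c3 := hk3 U
      grind [mem_sep_iff]
  have t1 := rdist_triangle z k x
  have t2 := rdist_triangle k m x
  rw [rdist_comm z k] at t1
  omega

end RAAG

namespace RAAG

/-! ### The Morse property for contracting projections -/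

/-- Chains of long blocks: if `f` moves by at most `c` over blocks of length at most `B`, then it
moves by at most `c * (n / B + 1)` over an interval of length `n`. -/
theorem le_of_le_on_blocks {X : Type*} {d : X → X → ℝ}
    (htri : ∀ x y z, d x z ≤ d x y + d y z) {f : ℕ → X} {i j B : ℕ} {c : ℝ} (hB : 0 < B)
    (hc : 0 ≤ c) (h : ∀ s t, i ≤ s → s ≤ t → t ≤ j → t ≤ s + B → d (f s) (f t) ≤ c) (hij : i ≤ j) :
    d (f i) (f j) ≤ c * (((j - i : ℕ) : ℝ) / B + 1) := by
  have hB' : (0 : ℝ) < B := by exact_mod_cast hB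
  induction hn : j - i using Nat.strong_induction_on generalizing i with
  | _ n ih =>
    by_cases hle : j ≤ i + B
    · have h1 := h i j le_rfl hij le_rfl hle
      have h2 : 0 ≤ c * ((n : ℝ) / B) := by positivity
      linarith [mul_add c ((n : ℝ) / B) 1]
    · push Not at hle
      have h1 := h i (i + B) le_rfl (by omega) hle.le le_rfl
      have h2 := ih (j - (i + B)) (by omega) (i := i + B)
        (fun s t hs => h s t (by omega)) hle.le rfl
      have h3 := htri (f i) (f (i + B)) (f j)
      have h4 : ((j - (i + B) : ℕ) : ℝ) = n - B := by
        rw [← hn, Nat.cast_sub hle.le, Nat.cast_sub hij]; push_cast; ring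
      rw [h4, sub_div, div_self hB'.ne'] at h2
      linarith [mul_add c ((n : ℝ) / B) 1]

/-- The length of blocks over which projections of quasi-geodesics barely move. -/
noncomputable def morseBlock (K N : ℝ) : ℕ := ⌈4 * N * K⌉₊ + 1

/-- The radius outside of which projections are estimated. -/
noncomputable def morseRadius (K L N : ℝ) : ℝ := K * morseBlock K N + L + 1

/-- A bound for the length of an excursion. -/
noncomputable def morseExcursion (K L N : ℝ) : ℝ :=
  2 * K * (L + 2 * morseRadius K L N + 2 * (K + L) + 2 * N)

/-- A bound for the distance from a quasi-geodesic to the image of the projection. -/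
noncomputable def morseBound (K L N : ℝ) : ℝ :=
  morseRadius K L N + 2 * (K * morseExcursion K L N + L)

/-- Quasi-geodesic sequences with endpoints fixed by a contracting projection stay close to the
image of the projection. -/
theorem le_morseBound {X : Type*} {d : X → X → ℝ} (hself : ∀ x, d x x = 0)
    (hsymm : ∀ x y, d x y = d y x) (htri : ∀ x y z, d x z ≤ d x y + d y z)
    {K L N : ℝ} (hK : 1 ≤ K) (hL : 0 ≤ L) (hN : 0 ≤ N)
    {z m : ℕ → X} {n : ℕ}
    (hz : IsQIEmbeddingOn (fun i j : ℕ => |(i : ℝ) - j|) d K L {i | i ≤ n} z)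
    (hlip : ∀ i j, d (m i) (m j) ≤ d (z i) (z j))
    (hcon : ∀ i j, d (m i) (m j) ≤ 2 * N ∨ d (z i) (m i) + d (z j) (m j) ≤ d (z i) (z j))
    (h0 : z 0 = m 0) (hn : z n = m n) {k : ℕ} (hk : k ≤ n) :
    d (z k) (m k) ≤ morseBound K L N := by
  have hR0 : 0 ≤ morseRadius K L N := by unfold morseRadius; positivity
  have hT0 : 0 ≤ morseExcursion K L N := by unfold morseExcursion; positivity
  have hup : ∀ s t, s ≤ t → t ≤ n → d (z s) (z t) ≤ K * ((t - s : ℕ) : ℝ) + L := by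
    intro s t hst htn
    have := (hz s (hst.trans htn) t htn).2
    beta_reduce at this
    rwa [abs_sub_comm, abs_of_nonneg (by simpa using hst), ← Nat.cast_sub hst] at this
  have hlow : ∀ s t, s ≤ t → t ≤ n → 1 / K * ((t - s : ℕ) : ℝ) - L ≤ d (z s) (z t) := by
    intro s t hst htn
    have := (hz s (hst.trans htn) t htn).1
    beta_reduce at this
    rwa [abs_sub_comm, abs_of_nonneg (by simpa using hst), ← Nat.cast_sub hst] at this
  set D := morseRadius K L N with hD
  set B := morseBlock K N with hB
  have hB1 : 0 < B := Nat.succ_pos _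
  have hBpos : (0 : ℝ) < B := by exact_mod_cast hB1
  have hB4 : 4 * N * K ≤ B := by
    have := Nat.le_ceil (4 * N * K)
    rw [hB, morseBlock]; push_cast; linarith
  by_cases hkD : d (z k) (m k) ≤ D
  · have : 0 ≤ K * morseExcursion K L N := by positivity
    unfold morseBound; rw [← hD]; linarith
  push Not at hkD
  classical
  -- The last time before `k` and the first time after `k` near the image of the projection.
  obtain ⟨i, hik, hiD, hi⟩ : ∃ i, i < k ∧ d (z i) (m i) ≤ D ∧
      ∀ t, i < t → t ≤ k → D < d (z t) (m t) := by
    have hex : ∃ t, t ≤ k ∧ d (z (k - t)) (m (k - t)) ≤ D :=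
      ⟨k, le_rfl, by rw [Nat.sub_self, h0, hself]; exact hR0⟩
    have hs := Nat.find_spec hex
    refine ⟨k - Nat.find hex, ?_, hs.2, fun t ht htk => ?_⟩
    · have : Nat.find hex ≠ 0 := fun h => by
        have := hs.2
        rw [h, Nat.sub_zero] at this
        linarith
      omega
    · have := Nat.find_min hex (m := k - t) (by omega)
      push Not at this
      have := this (by omega)
      rwa [Nat.sub_sub_self htk] at this
  obtain ⟨j, hkj, hjn, hjD, hj⟩ : ∃ j, k < j ∧ j ≤ n ∧ d (z j) (m j) ≤ D ∧
      ∀ t, k ≤ t → t < j → D < d (z t) (m t) := by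
    have hex : ∃ t, k ≤ t ∧ d (z t) (m t) ≤ D := ⟨n, hk, by rw [hn, hself]; exact hR0⟩
    have hs := Nat.find_spec hex
    refine ⟨Nat.find hex, ?_, Nat.find_le ⟨hk, by rw [hn, hself]; exact hR0⟩, hs.2,
      fun t ht htj => ?_⟩
    · refine lt_of_le_of_ne hs.1 fun h => ?_
      have := hs.2
      rw [← h] at this
      linarith
    · have := Nat.find_min hex htj
      push Not at this
      exact this ht
  have hfar : ∀ t, i < t → t < j → D < d (z t) (m t) := fun t h1 h2 => by
    rcases le_total t k with h | h
    · exact hi t h1 h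
    · exact hj t h h2
  -- Both points are farther than `D` from their projections, while `2 * D` exceeds `K * B + L`, so
  -- only the first alternative of `hcon` survives.
  have hblock : ∀ s t, i + 1 ≤ s → s ≤ t → t ≤ j - 1 → t ≤ s + B → d (m s) (m t) ≤ 2 * N := by
    intro s t h1 h2 h3 h4
    rcases hcon s t with h | h
    · exact h
    · have e1 := hfar s (by omega) (by omega)
      have e2 := hfar t (by omega) (by omega)
      have e3 := hup s t h2 (by omega)
      have e4 : ((t - s : ℕ) : ℝ) ≤ B := by exact_mod_cast (by omega : t - s ≤ B)
      have e5 : K * ((t - s : ℕ) : ℝ) ≤ K * B := by gcongr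
      have e6 : D = K * B + L + 1 := rfl
      have e7 : 0 ≤ K * B := by positivity
      linarith
  have hm := le_of_le_on_blocks htri hB1 (by positivity) hblock (by omega)
  have hlen : ((j - 1 - (i + 1) : ℕ) : ℝ) ≤ ((j - i : ℕ) : ℝ) := by
    exact_mod_cast (by omega : j - 1 - (i + 1) ≤ j - i)
  -- By the choice of `B`, the projection advances at no more than half the minimal speed `1 / K` of
  -- the quasi-geodesic.
  have hm' : d (m (i + 1)) (m (j - 1)) ≤ ((j - i : ℕ) : ℝ) / (2 * K) + 2 * N := by
    have e1 : 2 * N * (((j - 1 - (i + 1) : ℕ) : ℝ) / B) ≤ ((j - i : ℕ) : ℝ) / (2 * K) := by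
      rw [le_div_iff₀ (by positivity), mul_div_assoc', div_mul_eq_mul_div, div_le_iff₀ hBpos]
      calc 2 * N * ((j - 1 - (i + 1) : ℕ) : ℝ) * (2 * K)
          = ((j - 1 - (i + 1) : ℕ) : ℝ) * (4 * N * K) := by ring
        _ ≤ ((j - i : ℕ) : ℝ) * B := by gcongr
    linarith [mul_add (2 * N) (((j - 1 - (i + 1) : ℕ) : ℝ) / B) 1]
  have hi1 : d (m i) (m (i + 1)) ≤ K + L := by
    have := (hlip i (i + 1)).trans (hup i (i + 1) (by omega) (by omega))
    simpa using this
  have hj1 : d (m (j - 1)) (m j) ≤ K + L := by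
    have := (hlip (j - 1) j).trans (hup (j - 1) j (by omega) (by omega))
    rw [show j - (j - 1) = 1 by omega] at this
    simpa using this
  have hij : d (z i) (z j) ≤ 2 * D + 2 * (K + L) + ((j - i : ℕ) : ℝ) / (2 * K) + 2 * N := by
    have t1 := htri (z i) (m i) (z j)
    have t2 := htri (m i) (m j) (z j)
    have t3 := htri (m i) (m (i + 1)) (m j)
    have t4 := htri (m (i + 1)) (m (j - 1)) (m j)
    rw [hsymm (m j)] at t2
    linarith
  -- The lower quasi-geodesic bound is twice the linear term of `hij`; absorbing that term bounds
  -- the excursion.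
  have hexc : ((j - i : ℕ) : ℝ) ≤ morseExcursion K L N := by
    have := (hlow i j (by omega) hjn).trans hij
    unfold morseExcursion
    rw [← hD]
    have e : 1 / K * ((j - i : ℕ) : ℝ) = 2 * (((j - i : ℕ) : ℝ) / (2 * K)) := by
      field_simp
    have e2 : ((j - i : ℕ) : ℝ) / (2 * K) ≤ L + 2 * D + 2 * (K + L) + 2 * N := by linarith
    rw [div_le_iff₀ (by positivity)] at e2
    linarith
  have hki : d (z i) (z k) ≤ K * morseExcursion K L N + L := by
    refine (hup i k hik.le hk).trans ?_
    have : ((k - i : ℕ) : ℝ) ≤ ((j - i : ℕ) : ℝ) := by exact_mod_cast (by omega : k - i ≤ j - i)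
    gcongr
    linarith
  have t1 := htri (z k) (z i) (m k)
  have t2 := htri (z i) (m i) (m k)
  have t3 := hlip i k
  rw [hsymm (z k) (z i)] at t1
  unfold morseBound
  rw [← hD]
  linarith

/-- Discrete intermediate value theorem. -/
theorem exists_abs_sub_le {f : ℕ → ℝ} {n : ℕ} {c y : ℝ} (h0 : f 0 ≤ y) (hn : y ≤ f n)
    (hc : 0 ≤ c) (hf : ∀ i < n, f (i + 1) ≤ f i + c) : ∃ i ≤ n, |f i - y| ≤ c := by
  classical
  have hex : ∃ i, y ≤ f i := ⟨n, hn⟩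
  have hs := Nat.find_spec hex
  have hle := Nat.find_le (h := hex) hn
  refine ⟨Nat.find hex, hle, ?_⟩
  rw [abs_of_nonneg (by linarith)]
  rcases Nat.eq_zero_or_pos (Nat.find hex) with h | h
  · rw [h]; linarith
  · have h1 := Nat.find_min hex (m := Nat.find hex - 1) (by omega)
    have h2 := hf (Nat.find hex - 1) (by omega)
    rw [Nat.sub_add_cancel h] at h2
    push Not at h1
    linarith

end RAAG

/-! ### Word metrics -/

section WordMetric

variable {G : Type*} [Group G] {S : Set G}

theorem SimpleGraph.mulCayley_connected (hS : Subgroup.closure S = ⊤) :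
    (SimpleGraph.mulCayley S).Connected := by
  have : Nonempty G := ⟨1⟩
  have hedge : ∀ x s, s ∈ S → (SimpleGraph.mulCayley S).Reachable x (x * s) := by
    intro x s hs
    by_cases h : x = x * s
    · rw [← h]
    · exact SimpleGraph.Adj.reachable
        ((SimpleGraph.mulCayley_adj' S _ _).2 ⟨h, s, hs, Or.inl rfl⟩)
  have key : ∀ g x, (SimpleGraph.mulCayley S).Reachable x (x * g) := by
    intro g
    have hg : g ∈ Subgroup.closure S := by rw [hS]; trivial
    induction hg using Subgroup.closure_induction'' with
    | mem s hs => exact fun x => hedge x s hs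
    | inv_mem s hs => exact fun x => by simpa using (hedge (x * s⁻¹) s hs).symm
    | one => intro x; rw [mul_one]
    | mul g h _ _ hg hh => exact fun x => (hg x).trans (by rw [← mul_assoc]; exact hh (x * g))
  refine SimpleGraph.Connected.mk fun x y => ?_
  have := key (x⁻¹ * y) x
  rwa [mul_inv_cancel_left] at this

theorem wordDist_nonneg (x y : G) : 0 ≤ wordDist S x y := Nat.cast_nonneg _

theorem wordDist_comm (x y : G) : wordDist S x y = wordDist S y x :=
  congrArg Nat.cast SimpleGraph.dist_comm

theorem wordDist_triangle (hS : Subgroup.closure S = ⊤) (x y z : G) :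
    wordDist S x z ≤ wordDist S x y + wordDist S y z := by
  unfold wordDist graphDist
  exact_mod_cast (SimpleGraph.mulCayley_connected hS).dist_triangle

theorem wordDist_mul_left (hS : Subgroup.closure S = ⊤) (g x y : G) :
    wordDist S (g * x) (g * y) = wordDist S x y := by
  have key : ∀ g x y : G, (SimpleGraph.mulCayley S).dist (g * x) (g * y) ≤
      (SimpleGraph.mulCayley S).dist x y := by
    intro g x y
    obtain ⟨p, hp⟩ := (SimpleGraph.mulCayley_connected hS).exists_walk_length_eq_dist x y
    let φ : SimpleGraph.mulCayley S →g SimpleGraph.mulCayley S :=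
      ⟨fun x => g * x, fun h => SimpleGraph.mulCayley_adj_mul_iff_right.2 h⟩
    rw [← hp, ← SimpleGraph.Walk.length_map φ p]
    exact SimpleGraph.dist_le _
  refine congrArg Nat.cast (le_antisymm (key g x y) ?_)
  simpa using key g⁻¹ (g * x) (g * y)

/-- Homomorphisms are Lipschitz for word metrics. -/
theorem exists_wordDist_map_le {H : Type*} [Group H] {T : Set H} (f : H →* G)
    (hS : Subgroup.closure S = ⊤) (hT : IsFiniteGenSet T) :
    ∃ C : ℝ, 1 ≤ C ∧ ∀ x y, wordDist S (f x) (f y) ≤ C * wordDist T x y := by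
  obtain ⟨C, hC⟩ := (hT.1.image fun t => wordDist S 1 (f t)).bddAbove
  have hC' : ∀ t ∈ T, ∀ x, wordDist S (f x) (f (x * t)) ≤ max C 1 := by
    intro t ht x
    have : wordDist S 1 (f t) ≤ C := hC ⟨t, ht, rfl⟩
    rw [← wordDist_mul_left hS (f x), mul_one, ← map_mul] at this
    exact this.trans (le_max_left _ _)
  have hadj : ∀ x y, (SimpleGraph.mulCayley T).Adj x y → wordDist S (f x) (f y) ≤ max C 1 := by
    intro x y h
    obtain ⟨-, t, ht, rfl | rfl⟩ := (SimpleGraph.mulCayley_adj' T x y).1 h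
    · exact hC' t ht x
    · rw [wordDist_comm]; exact hC' t ht y
  refine ⟨max C 1, le_max_right _ _, fun x y => ?_⟩
  obtain ⟨p, hp⟩ := (SimpleGraph.mulCayley_connected hT.2).exists_walk_length_eq_dist x y
  have key : ∀ {x y} (p : (SimpleGraph.mulCayley T).Walk x y),
      wordDist S (f x) (f y) ≤ max C 1 * p.length := by
    intro x y p
    induction p with
    | nil => simp [wordDist, graphDist]
    | cons h p ih =>
      have h1 := hadj _ _ h
      have h2 := wordDist_triangle hS (f _) (f _) (f _) |>.trans (add_le_add h1 ih)
      refine h2.trans (le_of_eq ?_)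
      rw [SimpleGraph.Walk.length_cons]; push_cast; ring
  have := key p
  rwa [hp] at this

end WordMetric

/-! ### Sampling quasi-geodesics -/

/-- Every interval `[a, b]` of `T` contains a sequence from `a` to `b`, nearly isometric to an
interval of integers, and `1`-dense. -/
def HasSampling (T : Type) [PseudoMetricSpace T] [Preorder T] : Prop :=
  ∀ a b : T, a ≤ b → ∃ (n : ℕ) (t : ℕ → T), t 0 = a ∧ t n = b ∧ (∀ i ≤ n, t i ∈ Set.Icc a b) ∧
    (∀ i ≤ n, ∀ j ≤ n, |(i : ℝ) - j| - 1 ≤ dist (t i) (t j) ∧ dist (t i) (t j) ≤ |(i : ℝ) - j|) ∧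
    ∀ s ∈ Set.Icc a b, ∃ i ≤ n, dist s (t i) ≤ 1

theorem hasSampling_int : HasSampling ℤ := by
  intro a b hab
  have hn : ((b - a).toNat : ℤ) = b - a := Int.toNat_of_nonneg (by omega)
  refine ⟨(b - a).toNat, fun i => a + i, by simp, by simp [hn], fun i hi => ?_,
    fun i _ j _ => ?_, fun s hs => ⟨(s - a).toNat, ?_, ?_⟩⟩
  · simp only [Set.mem_Icc]; omega
  · have : dist (a + (i : ℤ)) (a + j) = |(i : ℝ) - j| := by
      rw [Int.dist_eq]; push_cast; congr 1; ring
    rw [this]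
    constructor <;> linarith
  · have := hs.1; have := hs.2; omega
  · have : a + ((s - a).toNat : ℤ) = s := by have := hs.1; omega
    beta_reduce
    rw [this, dist_self]
    exact zero_le_one

/-- Unit steps from `a`, truncated at `b`. Only the last step can be shorter than one, which costs
at most 1 in the lower bound. -/
theorem hasSampling_real : HasSampling ℝ := by
  intro a b hab
  have hb : ∀ i < ⌈b - a⌉₊, a + i < b := fun i hi => by
    have := Nat.lt_ceil.1 hi; linarith
  have hbn : b ≤ a + (⌈b - a⌉₊ : ℕ) := by have := Nat.le_ceil (b - a); linarith
  have key : ∀ i j : ℕ, i < j → j ≤ ⌈b - a⌉₊ →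
      |(i : ℝ) - j| - 1 ≤ dist (min (a + i) b) (min (a + j) b) ∧
        dist (min (a + i) b) (min (a + j) b) ≤ |(i : ℝ) - j| := by
    intro i j hij hj
    have hij' : (i : ℝ) + 1 ≤ j := by exact_mod_cast hij
    have h1 := hb i (by omega)
    have h2 := hb (j - 1) (by omega)
    rw [Nat.cast_sub (by omega)] at h2
    push_cast at h2
    have h3 : a + (i : ℝ) ≤ min (a + j) b := le_min (by linarith) h1.le
    have h4 : |(i : ℝ) - j| = j - i := by
      rw [abs_sub_comm, abs_of_nonneg (by linarith)]
    rw [min_eq_left h1.le, dist_comm, Real.dist_eq, h4, abs_of_nonneg (by linarith)]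
    constructor
    · have : a + (j : ℝ) - 1 ≤ min (a + j) b := le_min (by linarith) (by linarith)
      linarith
    · have := min_le_left (a + (j : ℝ)) b
      linarith
  refine ⟨⌈b - a⌉₊, fun i => min (a + i) b, by simp [hab], min_eq_right hbn,
    fun i _ => ⟨le_min (by simp) hab, min_le_right _ _⟩, fun i hi j hj => ?_, fun s hs =>
    ⟨⌊s - a⌋₊, ?_, ?_⟩⟩
  · rcases lt_trichotomy i j with h | rfl | h
    · exact key i j h hj
    · simp
    · rw [abs_sub_comm, dist_comm]; exact key j i h hi
  · exact (Nat.floor_mono (by linarith [hs.2])).trans (Nat.floor_le_ceil _)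
  · have h1 := Nat.floor_le (show 0 ≤ s - a by linarith [hs.1])
    have h2 := Nat.lt_floor_add_one (s - a)
    have := hs.2
    beta_reduce
    rw [min_eq_left (by linarith), Real.dist_eq, abs_of_nonneg (by linarith)]
    linarith

theorem SimpleGraph.Walk.IsGeodesicPath.dist_getVert {X : Type*} {G : SimpleGraph X} {x y : X}
    {p : G.Walk x y} (hp : p.IsGeodesicPath) (hG : G.Connected) {i : ℕ} (hi : i ≤ p.length) :
    G.dist x (p.getVert i) = i ∧ G.dist x (p.getVert i) + G.dist (p.getVert i) y = G.dist x y := by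
  have h1 := SimpleGraph.dist_le (p.take i)
  have h2 := SimpleGraph.dist_le (p.drop i)
  have h3 := hG.dist_triangle (u := x) (v := p.getVert i) (w := y)
  rw [SimpleGraph.Walk.take_length] at h1
  rw [SimpleGraph.Walk.drop_length] at h2
  have h4 : p.length = G.dist x y := hp
  have h5 := min_le_left i p.length
  omega

namespace RAAG

variable {V : Type*} {Γ : SimpleGraph V}

/-! ### Quasi-geodesics with join-busting endpoints -/

theorem rdist_cast_triangle (x y z : RAAG Γ) :
    graphDist (oneSkeleton Γ) x z ≤ graphDist (oneSkeleton Γ) x y + graphDist (oneSkeleton Γ) y z := by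
  unfold graphDist
  exact_mod_cast rdist_triangle x y z

theorem graphDist_comm (x y : RAAG Γ) :
    graphDist (oneSkeleton Γ) x y = graphDist (oneSkeleton Γ) y x :=
  congrArg Nat.cast (rdist_comm x y)

theorem IsMedian.eq_left {m a b : RAAG Γ} (h : IsMedian m a b a) : a = m :=
  eq_of_sep_eq_empty fun W hW => by
    have := h.2.2 W
    grind [mem_sep_iff]

theorem IsMedian.eq_right {m a b : RAAG Γ} (h : IsMedian m a b b) : b = m :=
  eq_of_sep_eq_empty fun W hW => by
    have := h.2.1 W
    grind [mem_sep_iff]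

/-- Distance from `a` is a coarse coordinate on the interval. -/
theorem JoinBustingPair.abs_bound {N : ℕ} {a b y z : RAAG Γ} (h : JoinBustingPair N a b)
    (hy : Btw a y b) (hz : Btw a z b) : graphDist (oneSkeleton Γ) y z ≤ 2 * N +
      |graphDist (oneSkeleton Γ) a z - graphDist (oneSkeleton Γ) a y| := by
  change ((rdist Γ y z : ℕ) : ℝ) ≤ 2 * N + |((rdist Γ a z : ℕ) : ℝ) - (rdist Γ a y : ℕ)|
  rcases h.rdist_le_of_btw hy hz with h | h | h
  · have : ((rdist Γ y z : ℕ) : ℝ) ≤ 2 * N := by exact_mod_cast h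
    have := abs_nonneg (((rdist Γ a z : ℕ) : ℝ) - (rdist Γ a y : ℕ))
    linarith
  · rw [← h]; push_cast
    rw [add_sub_cancel_left, abs_of_nonneg (by positivity)]
    have : (0 : ℝ) ≤ N := Nat.cast_nonneg _
    linarith
  · rw [← h]; push_cast
    rw [sub_add_cancel_left, abs_neg, abs_of_nonneg (by positivity)]
    have : (0 : ℝ) ≤ N := Nat.cast_nonneg _
    linarith

/-- Quasi-geodesic sequences between the vertices of a join-busting pair are close to the
interval. -/
theorem JoinBustingPair.hausdorff_interval {N : ℕ} {a b : RAAG Γ} (h : JoinBustingPair N a b)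
    {K L : ℝ} (hK : 1 ≤ K) (hL : 0 ≤ L) {z : ℕ → RAAG Γ} {n : ℕ}
    (hz : IsQIEmbeddingOn (fun i j : ℕ => |(i : ℝ) - j|) (graphDist (oneSkeleton Γ)) K L
      {i | i ≤ n} z) (h0 : z 0 = a) (hn : z n = b) :
    (∀ k ≤ n, ∃ y, Btw a y b ∧ graphDist (oneSkeleton Γ) (z k) y ≤ morseBound K L N) ∧
    (∀ y, Btw a y b → ∃ k ≤ n,
      graphDist (oneSkeleton Γ) y (z k) ≤ 2 * N + (K + L) + morseBound K L N) := by
  choose m hm using fun k => exists_isMedian a b (z k)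
  have m0 : a = m 0 := by have := hm 0; rw [h0] at this; exact this.eq_left
  have mn : b = m n := by have := hm n; rw [hn] at this; exact this.eq_right
  have hlip : ∀ i j, graphDist (oneSkeleton Γ) (m i) (m j) ≤ graphDist (oneSkeleton Γ) (z i) (z j) :=
    fun i j => Nat.cast_le.2 ((hm i).rdist_le (hm j))
  have hclose : ∀ k ≤ n, graphDist (oneSkeleton Γ) (z k) (m k) ≤ morseBound K L N := by
    intro k hk
    refine le_morseBound (fun x => by simp [graphDist]) graphDist_comm rdist_cast_triangle hK hL
      (Nat.cast_nonneg N) hz hlip (fun i j => ?_) (h0.trans m0) (hn.trans mn) hk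
    rcases h.contraction (hm i) (hm j) with hc | hc
    · exact Or.inl (by unfold graphDist; exact_mod_cast hc)
    · right
      have : rdist Γ (z i) (m i) + rdist Γ (z j) (m j) ≤ rdist Γ (z i) (z j) := by
        rw [rdist_comm (z j)]; omega
      unfold graphDist
      exact_mod_cast this
  refine ⟨fun k hk => ⟨m k, (hm k).1, hclose k hk⟩, fun y hy => ?_⟩
  -- The projected sequence runs from `a` to `b`, its distance from `a` growing by at most `K + L`
  -- per step, so it comes near the level of `y`; thinness of the interval does the rest.
  obtain ⟨i, hi, hd⟩ := exists_abs_sub_le (f := fun i => graphDist (oneSkeleton Γ) a (m i)) (n := n)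
    (c := K + L) (y := graphDist (oneSkeleton Γ) a y) (by
      rw [← m0]; simp [graphDist]) (by
      rw [← mn]
      have := btw_iff.1 hy
      exact Nat.cast_le.2 (show rdist Γ a y ≤ rdist Γ a b by omega)) (by linarith) (by
      intro i hi
      have h1 := rdist_cast_triangle a (m i) (m (i + 1))
      have h2 := hlip i (i + 1)
      have h3 := (hz i hi.le (i + 1) hi).2
      have h4 : |(i : ℝ) - ((i + 1 : ℕ) : ℝ)| = 1 := by push_cast; simp
      beta_reduce at h3 ⊢
      rw [h4] at h3
      linarith)
  refine ⟨i, hi, ?_⟩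
  have h1 := h.abs_bound hy (hm i).1
  have h2 := hclose i hi
  have h3 := rdist_cast_triangle y (m i) (z i)
  rw [graphDist_comm (m i)] at h3
  linarith

theorem btw_of_mem_support {a b z : RAAG Γ} {w : (oneSkeleton Γ).Walk a b} (hw : w.IsGeodesicPath)
    (hz : z ∈ w.support) : Btw a z b := by
  obtain ⟨i, rfl, hi⟩ := SimpleGraph.Walk.mem_support_iff_exists_getVert.1 hz
  exact btw_iff.2 (hw.dist_getVert (oneSkeleton_connected Γ) hi).2

/-- Compare `y` with the vertex of the geodesic at the same distance from `a`. -/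
theorem JoinBustingPair.exists_mem_support {N : ℕ} {a b y : RAAG Γ} (h : JoinBustingPair N a b)
    {w : (oneSkeleton Γ).Walk a b} (hw : w.IsGeodesicPath) (hy : Btw a y b) :
    ∃ z ∈ w.support, graphDist (oneSkeleton Γ) y z ≤ 2 * N := by
  have hle : rdist Γ a y ≤ w.length := by
    have h1 := btw_iff.1 hy
    have h2 : w.length = rdist Γ a b := hw
    omega
  have hd := (hw.dist_getVert (oneSkeleton_connected Γ) hle).1
  refine ⟨_, w.getVert_mem_support (rdist Γ a y), ?_⟩
  have := h.abs_bound hy (btw_of_mem_support hw (w.getVert_mem_support (rdist Γ a y)))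
  have e : graphDist (oneSkeleton Γ) a (w.getVert (rdist Γ a y)) =
      graphDist (oneSkeleton Γ) a y := congrArg Nat.cast hd
  rw [e, sub_self, abs_zero, add_zero] at this
  exact this

theorem IsJoinBusting.hausdorffDistLE {N : ℕ} {K : ℝ} (hK : 1 ≤ K) {g : RAAG Γ}
    (hg : IsJoinBusting Γ N g) {p w : (oneSkeleton Γ).Walk 1 g} (hp : p.IsQuasiGeodesicPath K)
    (hw : w.IsGeodesicPath) :
    HausdorffDistLE (graphDist (oneSkeleton Γ)) (2 * N + (K + K) + morseBound K K N)
      p.vertexSet w.vertexSet := by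
  have h : JoinBustingPair N 1 g := IsJoinBusting.joinBustingPair (by simpa using hg)
  obtain ⟨h1, h2⟩ := h.hausdorff_interval hK (by linarith) hp p.getVert_zero p.getVert_length
  constructor
  · intro z hz
    obtain ⟨i, rfl, hi⟩ := SimpleGraph.Walk.mem_support_iff_exists_getVert.1 hz
    obtain ⟨y, hy, hd⟩ := h1 i hi
    obtain ⟨u, hu, hd'⟩ := h.exists_mem_support hw hy
    refine ⟨u, hu, ?_⟩
    have := rdist_cast_triangle (p.getVert i) y u
    linarith
  · intro z hz
    obtain ⟨k, -, hd⟩ := h2 z (btw_of_mem_support hw hz)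
    exact ⟨p.getVert k, p.getVert_mem_support k, by rw [graphDist_comm]; exact hd⟩

/-! ### Join-busting subgroups -/

theorem rdist_mul_left (g x y : RAAG Γ) : rdist Γ (g * x) (g * y) = rdist Γ x y := by
  obtain ⟨w, hw, hr⟩ := exists_isReduced (x⁻¹ * y)
  obtain rfl : x * eval Γ w = y := by rw [hw]; group
  rw [hr.rdist_eq, ← mul_assoc, hr.rdist_eq]

/-- A path of generators from `a` to `a * h` changes sides of `W` during one of its jumps. The base
point varies so that a product can be split. -/
theorem exists_mem_sep_of_closure {S : Set (RAAG Γ)} {C : ℕ} (hC : ∀ s ∈ S, rdist Γ 1 s ≤ C)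
    {h : RAAG Γ} (hh : h ∈ Subgroup.closure S) {W : Wall Γ} :
    ∀ a ∈ Subgroup.closure S, W ∈ Sep a (a * h) →
      ∃ x ∈ Subgroup.closure S, ∃ x' ∈ Subgroup.closure S, W ∈ Sep x x' ∧ rdist Γ x x' ≤ C := by
  induction hh using Subgroup.closure_induction'' with
  | mem s hs =>
    intro a ha hW
    refine ⟨a, ha, _, mul_mem ha (Subgroup.subset_closure hs), hW, ?_⟩
    have := rdist_mul_left a 1 s
    rw [mul_one] at this
    exact this ▸ hC s hs
  | inv_mem s hs =>
    intro a ha hW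
    refine ⟨a, ha, _, mul_mem ha (inv_mem (Subgroup.subset_closure hs)), hW, ?_⟩
    have := rdist_mul_left (a * s⁻¹) 1 s
    rw [mul_one, inv_mul_cancel_right, rdist_comm] at this
    exact this ▸ hC s hs
  | one =>
    intro a _ hW
    simp [mem_sep_iff] at hW
  | mul g h hg _ ihg ihh =>
    intro a ha hW
    by_cases h1 : W ∈ Sep a (a * g)
    · exact ihg a ha h1
    · refine ihh (a * g) (mul_mem ha hg) ?_
      rw [mul_assoc]
      grind [mem_sep_iff]

theorem IsJoinBustingSubgroup.isQuasiconvex {H : Subgroup (RAAG Γ)} (hfg : H.FG)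
    (hH : IsJoinBustingSubgroup Γ H) : (oneSkeleton Γ).IsQuasiconvex (H : Set (RAAG Γ)) := by
  obtain ⟨N, hN⟩ := hH
  have hJ : ∀ x ∈ H, ∀ y ∈ H, JoinBustingPair N x y := fun x hx y hy =>
    (hN _ (mul_mem (inv_mem hx) hy)).joinBustingPair
  obtain ⟨S, rfl⟩ := hfg
  let C := S.sup fun s => rdist Γ 1 s
  have hC : ∀ s ∈ (S : Set (RAAG Γ)), rdist Γ 1 s ≤ C := fun s hs =>
    Finset.le_sup (f := fun s => rdist Γ 1 s) hs
  refine ⟨(3 * (C * (N + 1) + N) : ℕ), fun a ha b hb p hp z hz => ?_⟩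
  have hbz := btw_of_mem_support hp hz
  by_cases hzb : z = b
  · exact ⟨z, hzb ▸ hb, by
      rw [graphDist, SimpleGraph.dist_self, Nat.cast_zero]; exact Nat.cast_nonneg _⟩
  obtain ⟨l, hl⟩ := exists_letter hzb
  have hab : wallAt z l ∈ Sep a (a * (a⁻¹ * b)) := by
    rw [mul_inv_cancel_left]
    have := hbz (wallAt z l)
    grind [mem_sep_iff]
  obtain ⟨x, hx, x', hx', hxx, hd⟩ :=
    exists_mem_sep_of_closure hC (mul_mem (inv_mem ha) hb) a ha hab
  -- Locates an edge of the same wall on a geodesic of length at most `C` between two elements of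
  -- the subgroup.
  rcases exists_first_wall {wallAt z l} x x' with h | ⟨r, l', h1, h2, h3, -⟩
  · exact absurd rfl (h _ hxx)
  have hr := btw_iff.1 h3
  have hr' := rdist_mul_letter_of_mem h2
  have hw : wallAt r l' = wallAt z l := h1
  have hzz : ∀ U, U ∈ Sep z (z * letter Γ l) ↔ U = wallAt z l := fun U => mem_sep_mul_letter
  have hrr : ∀ U, U ∈ Sep r (r * letter Γ l') ↔ U = wallAt z l := fun U =>
    hw ▸ mem_sep_mul_letter
  have htri := rdist_triangle (r * letter Γ l') r x
  rw [rdist_comm _ r, rdist_mul_letter, rdist_comm r x] at htri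
  refine ⟨x, hx, Nat.cast_le.2 ?_⟩
  -- Choose as `q` the end of this edge on the side of `z`. Both ends lie on a geodesic from `x` to
  -- `x'`, hence within `C` of `x`.
  by_cases hs : wallAt z l ∈ Sep z r
  · refine (hJ a ha b hb).rdist_le_of_common_wall (hJ a ha x hx) hbz hzz
      (q := r * letter Γ l') (q' := r) (fun U => ?_) ?_ (by omega)
    · rw [← hrr U]
      grind [mem_sep_iff]
    · have := (hrr (wallAt z l)).2 rfl
      grind [mem_sep_iff]
  · exact (hJ a ha b hb).rdist_le_of_common_wall (hJ a ha x hx) hbz hzz hrr hs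
      (by rw [rdist_comm]; omega)

/-! ### Undistortedness and stability -/

theorem finite_ball [Finite V] (n : ℕ) : {g : RAAG Γ | rdist Γ 1 g ≤ n}.Finite := by
  refine ((List.finite_length_le (V × Bool) n).image (eval Γ)).subset fun g hg => ?_
  obtain ⟨w, rfl, hr⟩ := exists_isReduced g
  have := hr.rdist_eq 1
  rw [one_mul] at this
  exact ⟨w, this.symm.trans_le hg, rfl⟩

/-- Word metrics on quasiconvex subgroups are controlled by the combinatorial distance. -/
theorem exists_wordDist_le_of_isQuasiconvex [Finite V] {H : Subgroup (RAAG Γ)}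
    (hH : (oneSkeleton Γ).IsQuasiconvex (H : Set (RAAG Γ))) {T : Set H}
    (hT : Subgroup.closure T = ⊤) : ∃ C : ℝ, 0 ≤ C ∧ ∀ x y : H,
      wordDist T x y ≤ C * graphDist (oneSkeleton Γ) x y + C := by
  obtain ⟨R, hR⟩ := hH
  -- Elements of `H` that are `R`-close to consecutive vertices of a geodesic differ by at most `2 *
  -- R + 1`; the finite ball gives one bound for the word length of all such jumps.
  have hfin : {h : H | rdist Γ 1 h ≤ ⌊2 * R + 1⌋₊}.Finite :=
    (finite_ball (Γ := Γ) ⌊2 * R + 1⌋₊).preimage Subtype.val_injective.injOn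
  obtain ⟨C, hC⟩ := (hfin.image fun h => wordDist T 1 h).bddAbove
  have hC' : ∀ x y : H, graphDist (oneSkeleton Γ) x y ≤ 2 * R + 1 → wordDist T x y ≤ C := by
    intro x y h
    have h1 : rdist Γ 1 ((x⁻¹ * y : H) : RAAG Γ) ≤ ⌊2 * R + 1⌋₊ := by
      refine Nat.le_floor ?_
      rw [← rdist_mul_left (x : RAAG Γ)]
      rw [mul_one, Subgroup.coe_mul, Subgroup.coe_inv, mul_inv_cancel_left]
      exact h
    have h2 : wordDist T 1 (x⁻¹ * y) ≤ C := hC ⟨x⁻¹ * y, h1, rfl⟩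
    rw [← wordDist_mul_left hT x] at h2
    simpa using h2
  have hC0 : 0 ≤ max C 0 := le_max_right _ _
  refine ⟨max C 0, hC0, fun x y => ?_⟩
  obtain ⟨p, hp⟩ := (oneSkeleton_connected Γ).exists_walk_length_eq_dist (x : RAAG Γ) y
  have hnear : ∀ i, ∃ c : H, graphDist (oneSkeleton Γ) (p.getVert i) c ≤ R := by
    intro i
    obtain ⟨c, hc, hd⟩ := hR x x.2 y y.2 p hp _ (p.getVert_mem_support i)
    exact ⟨⟨c, hc⟩, hd⟩
  have hR0 : 0 ≤ R := (Nat.cast_nonneg _).trans (hnear 0).choose_spec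
  have key : ∀ i ≤ p.length, ∀ c : H, graphDist (oneSkeleton Γ) (p.getVert i) c ≤ R →
      wordDist T x c ≤ max C 0 * i + max C 0 := by
    intro i
    induction i with
    | zero =>
      intro _ c hc
      rw [p.getVert_zero] at hc
      have := (hC' x c (by linarith)).trans (le_max_left C 0)
      simpa using this
    | succ i ih =>
      intro hi c hc
      obtain ⟨c', hc'⟩ := hnear i
      have h1 := ih (by omega) c' hc'
      have hadj : graphDist (oneSkeleton Γ) (p.getVert i) (p.getVert (i + 1)) = 1 := by
        rw [graphDist, SimpleGraph.dist_eq_one_iff_adj.2 (p.adj_getVert_succ hi), Nat.cast_one]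
      have t1 := rdist_cast_triangle (c' : RAAG Γ) (p.getVert i) c
      have t2 := rdist_cast_triangle (p.getVert i) (p.getVert (i + 1)) (c : RAAG Γ)
      rw [graphDist_comm (c' : RAAG Γ) (p.getVert i)] at t1
      have h2 := (hC' c' c (by linarith)).trans (le_max_left C 0)
      have h3 := wordDist_triangle hT x c' c
      push_cast
      linarith
  have := key p.length le_rfl y (by rw [p.getVert_length]; simpa [graphDist] using hR0)
  rwa [hp] at this

theorem isFiniteGenSet_gens [Finite V] : IsFiniteGenSet (gens Γ) :=
  ⟨Set.finite_range _, closure_gens⟩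

theorem isUndistorted_of_isQuasiconvex [Finite V] {H : Subgroup (RAAG Γ)}
    (hH : (oneSkeleton Γ).IsQuasiconvex (H : Set (RAAG Γ))) : H.IsUndistorted := by
  intro S T hS hT
  obtain ⟨C₁, h₁, hC₁⟩ := exists_wordDist_map_le H.subtype hS.2 hT
  obtain ⟨C₂, h₂, hC₂⟩ := exists_wordDist_le_of_isQuasiconvex hH hT.2
  obtain ⟨C₃, h₃, hC₃⟩ := exists_wordDist_map_le (MonoidHom.id (RAAG Γ)) (closure_gens (Γ := Γ)) hS
  have hK : 1 ≤ C₁ + C₂ * C₃ := by nlinarith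
  refine ⟨C₁ + C₂ * C₃, C₂, hK, h₂, fun x _ y _ => ⟨?_, ?_⟩⟩
  · have a1 := hC₂ x y
    have a2 : graphDist (oneSkeleton Γ) (x : RAAG Γ) y ≤ C₃ * wordDist S (x : RAAG Γ) y := hC₃ x y
    have a3 := wordDist_nonneg (S := S) (x : RAAG Γ) y
    rw [sub_le_iff_le_add, div_mul_eq_mul_div, one_mul, div_le_iff₀ (by linarith)]
    have a4 := mul_le_mul_of_nonneg_left a2 h₂
    nlinarith [mul_nonneg (zero_le_one.trans h₁) a3, mul_le_mul_of_nonneg_left hK h₂]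
  · have a1 : wordDist S (x : RAAG Γ) y ≤ C₁ * wordDist T x y := hC₁ x y
    have a2 := wordDist_nonneg (S := T) x y
    have a3 : 0 ≤ C₂ * C₃ * wordDist T x y := by positivity
    linarith

/-- Quasi-geodesics for a word metric between the vertices of a join-busting pair are uniformly
close to the interval. -/
theorem exists_hausdorff_interval [Finite V] {S : Set (RAAG Γ)} (hS : IsFiniteGenSet S) {K : ℝ}
    (hK : 1 ≤ K) (N : ℕ) : ∃ M : ℝ, 0 ≤ M ∧ ∀ a b : RAAG Γ, JoinBustingPair N a b →
      ∀ (T : Type) [PseudoMetricSpace T] [Preorder T], HasSampling T → ∀ A : Set (RAAG Γ),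
      IsQuasiGeodesicImage T (wordDist S) K a b A →
        HausdorffDistLE (wordDist S) M A {y | Btw a y b} := by
  obtain ⟨C₁, h₁, hC₁⟩ := exists_wordDist_map_le (MonoidHom.id (RAAG Γ)) (closure_gens (Γ := Γ)) hS
  obtain ⟨C₂, h₂, hC₂⟩ := exists_wordDist_map_le (MonoidHom.id (RAAG Γ)) hS.2
    (isFiniteGenSet_gens (Γ := Γ))
  replace hC₁ : ∀ x y, graphDist (oneSkeleton Γ) x y ≤ C₁ * wordDist S x y := hC₁
  replace hC₂ : ∀ x y, wordDist S x y ≤ C₂ * graphDist (oneSkeleton Γ) x y := hC₂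
  have hCC : 1 ≤ C₁ * C₂ := one_le_mul_of_one_le_of_one_le h₁ h₂
  -- The factor pays for changing generators; the additive constant `2 * K'` below also absorbs the
  -- unit lost in sampling.
  set K' := K * (C₁ * C₂) with hK'
  have hKK' : 1 ≤ K' := one_le_mul_of_one_le_of_one_le hK hCC
  set M₁ := 2 * N + (K' + 2 * K') + |morseBound K' (2 * K') N| with hM₁
  have hM₁0 : 0 ≤ M₁ := by positivity
  -- A point of the quasi-geodesic has a sample at parameter distance at most 1, so their images are
  -- `2 * K`-close; `C₂` converts the combinatorial bound.
  refine ⟨2 * K + C₂ * M₁, by positivity, fun a b hab T _ _ hT A ⟨s, e, f, hse, hf, hfs, hfe, hA⟩ =>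
    ?_⟩
  obtain ⟨n, t, ht0, htn, hmem, hdist, hdense⟩ := hT s e hse
  have hz : IsQIEmbeddingOn (fun i j : ℕ => |(i : ℝ) - j|) (graphDist (oneSkeleton Γ)) K' (2 * K')
      {i | i ≤ n} (fun i => f (t i)) := by
    intro i hi j hj
    obtain ⟨e1, e2⟩ := hf (t i) (hmem i hi) (t j) (hmem j hj)
    obtain ⟨e3, e4⟩ := hdist i hi j hj
    have e5 := hC₁ (f (t i)) (f (t j))
    have e6 := hC₂ (f (t i)) (f (t j))
    beta_reduce
    set D := |(i : ℝ) - j|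
    set G := graphDist (oneSkeleton Γ) (f (t i)) (f (t j))
    set Q := wordDist S (f (t i)) (f (t j))
    have hD : 0 ≤ D := abs_nonneg _
    have hG : 0 ≤ G := Nat.cast_nonneg _
    constructor
    · have b1 : D - 1 ≤ K * (C₂ * G + K) := by
        have : 1 / K * dist (t i) (t j) ≤ C₂ * G + K := by linarith
        rw [div_mul_eq_mul_div, one_mul, div_le_iff₀ (by linarith)] at this
        linarith
      rw [sub_le_iff_le_add, div_mul_eq_mul_div, one_mul, div_le_iff₀ (by linarith)]
      have b2 : K * C₂ ≤ K' := by
        rw [hK']; gcongr; nlinarith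
      have b3 : K * C₂ * G ≤ K' * G := by gcongr
      have b4 : K ≤ K' := by rw [hK']; nlinarith
      have b5 : K * K ≤ K' * K' := by gcongr
      nlinarith
    · have b1 : Q ≤ K * D + K := e2.trans (by gcongr)
      have b2 : C₁ * Q ≤ C₁ * (K * D + K) := by gcongr
      have b3 : K * C₁ ≤ K' := by
        rw [hK']; gcongr; nlinarith
      have b4 : K * C₁ * D ≤ K' * D := by gcongr
      nlinarith
  obtain ⟨g1, g2⟩ := hab.hausdorff_interval hKK' (by linarith) hz (by rw [ht0, hfs])
    (by rw [htn, hfe])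
  have habs := le_abs_self (morseBound K' (2 * K') N)
  have hN0 : (0 : ℝ) ≤ N := Nat.cast_nonneg N
  constructor
  · rintro x hx
    rw [← hA] at hx
    obtain ⟨u, hu, rfl⟩ := hx
    obtain ⟨i, hi, hd⟩ := hdense u hu
    obtain ⟨y, hy, hyd⟩ := g1 i hi
    refine ⟨y, hy, ?_⟩
    have b1 := (hf u hu (t i) (hmem i hi)).2
    have b2 : K * dist u (t i) ≤ K * 1 := by gcongr
    have b3 := wordDist_triangle hS.2 (f u) (f (t i)) y
    have b4 := hC₂ (f (t i)) y
    have b5 : C₂ * graphDist (oneSkeleton Γ) (f (t i)) y ≤ C₂ * M₁ := by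
      gcongr; linarith
    linarith
  · intro y hy
    obtain ⟨i, hi, hd⟩ := g2 y hy
    refine ⟨f (t i), hA ▸ ⟨t i, hmem i hi, rfl⟩, ?_⟩
    rw [wordDist_comm]
    have b4 := hC₂ y (f (t i))
    have b5 : C₂ * graphDist (oneSkeleton Γ) y (f (t i)) ≤ C₂ * M₁ := by
      gcongr; linarith
    linarith

/-- Two quasi-geodesics are compared through the interval between their endpoints, which doubles the
constant. -/
theorem IsJoinBustingSubgroup.isStable [Finite V] {H : Subgroup (RAAG Γ)} (hfg : H.FG)
    (hH : IsJoinBustingSubgroup Γ H) : H.IsStable where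
  group_fg := Group.fg_iff.2 ⟨gens Γ, closure_gens, Set.finite_range _⟩
  subgroup_fg := hfg
  undistorted := isUndistorted_of_isQuasiconvex (hH.isQuasiconvex hfg)
  quasiGeodesics_close := by
    intro S hS K hK
    obtain ⟨N, hN⟩ := hH
    obtain ⟨M, hM, hb⟩ := exists_hausdorff_interval hS hK N
    refine ⟨2 * M, by positivity, fun x hx y hy A B hA hB => ?_⟩
    have hJ : JoinBustingPair N x y := (hN _ (mul_mem (inv_mem hx) hy)).joinBustingPair
    have key : ∀ A, (IsQuasiGeodesicImage ℝ (wordDist S) K x y A ∨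
        IsQuasiGeodesicImage ℤ (wordDist S) K x y A) →
          HausdorffDistLE (wordDist S) M A {z | Btw x z y} := by
      rintro A (h | h)
      · exact hb x y hJ ℝ hasSampling_real A h
      · exact hb x y hJ ℤ hasSampling_int A h
    have sub : ∀ A B, HausdorffDistLE (wordDist S) M A {z | Btw x z y} →
        HausdorffDistLE (wordDist S) M B {z | Btw x z y} →
          ∀ u ∈ A, ∃ v ∈ B, wordDist S u v ≤ 2 * M := by
      intro A B hA hB u hu
      obtain ⟨z, hz, h1⟩ := hA.1 u hu
      obtain ⟨v, hv, h2⟩ := hB.2 z hz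
      refine ⟨v, hv, ?_⟩
      have := wordDist_triangle hS.2 u z v
      rw [wordDist_comm z v] at this
      linarith
    refine ⟨sub A B (key A hA) (key B hB), fun v hv => ?_⟩
    obtain ⟨u, hu, h⟩ := sub B A (key B hB) (key A hA) v hv
    exact ⟨u, hu, by rw [wordDist_comm]; exact h⟩

end RAAG

theorem theorem6p1 :
    (∀ (K : ℝ) (N : ℕ), 1 ≤ K →
      ∃ M : ℝ, ∀ (V : Type*) [Finite V] (Γ : SimpleGraph V), Γ.Connected → Γᶜ.Connected →
        ∀ g : RAAG Γ, RAAG.IsJoinBusting Γ N g →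
          ∀ p w : (RAAG.oneSkeleton Γ).Walk 1 g, p.IsQuasiGeodesicPath K → w.IsGeodesicPath →
            HausdorffDistLE (graphDist (RAAG.oneSkeleton Γ)) M p.vertexSet w.vertexSet) ∧
    (∀ (V : Type*) [Finite V] (Γ : SimpleGraph V), Γ.Connected → Γᶜ.Connected →
      ∀ H : Subgroup (RAAG Γ), H.FG → RAAG.IsJoinBustingSubgroup Γ H →
        H.IsStable ∧ (RAAG.oneSkeleton Γ).IsQuasiconvex (H : Set (RAAG Γ))) :=
  ⟨fun _ _ hK => ⟨_, fun _ _ _ _ _ _ hg _ _ hp hw => hg.hausdorffDistLE hK hp hw⟩,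
    fun _ _ _ _ _ _ hfg hH => ⟨hH.isStable hfg, hH.isQuasiconvex hfg⟩⟩
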